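/- **Setting.** A stream is a nonempty sequence $(x_1,y_1),\dots,(x_m,y_m)$ with $x_i\in\{1,\dots,N\}$ and $y_i\in\{0,1,\dots,M\}$. For a split $j\in\{0,1,\dots,N\}$ let $\mu(j)$ be the mean of the labels $y_i$ with $x_i\le j$, let $\gamma(j)$ be the mean of the labels $y_i$ with $x_i>j$, and let $$L(j)=\frac1m\Bigl(\sum_{i:\,x_i\le j}(y_i-\mu(j))^2+\sum_{i:\,x_i>j}(y_i-\gamma(j))^2\Bigr),\qquad \mathrm{OPT}=\min_{0\le j\le N}L(j)$$ (an empty sum is $0$). A randomized one-pass streaming algorithm consists of three programs of a random access machine that share one memory: the first is run before the stream, with $N$, $M$ and $\lceil 1/\epsilon\rceil$ as input; the second is run on each item $(x_i,y_i)$ when it arrives; the third is run after the last item and leaves the output in memory. The length $m$ is not an input. The machine can draw uniform random integers below a bound it has computed, and its costs are logarithmic: space is measured in bits (of the contents and addresses of all nonzero cells, and of temporary values), and each instruction takes time one plus the total bit length (plus one each) of the values that it handles. **Theorem.** For every $c\in\mathbb N$ there are a randomized one-pass streaming algorithm $\mathcal A$ and a constant $C$ such that for all $N$, $M\ge 0$,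 all real $\epsilon\in(0,1)$ and every stream as above of any length $m\geq 1$, with $\Lambda=\log(2+N+M+m+1/\epsilon)$: * for all outcomes of the random choices $\mathcal A$ halts and uses at most $C\,(1+M^2/\epsilon)\,\Lambda^C$ bits of space, that is, $\widetilde O(M^2/\epsilon)$ (for $M\ge1$); * for all outcomes of the random choices every update takes time at most $C\,\Lambda^C$, that is, $\widetilde O(1)$; * with probability at least $1-1/N^c$ the output is a split $\widehat{\jmath}\in\{0,1,\dots,N\}$ with $L(\widehat{\jmath})\le\mathrm{OPT}+\epsilon$. -/

import Mathlib

namespace SplitStream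

/-! ### The regression split problem -/

/-- Mean of a list of labels (only used in sums over the same list, so its value on the empty
list is irrelevant). -/
noncomputable def mean (ys : List ℕ) : ℝ := (ys.map fun y => (y : ℝ)).sum / ys.length

/-- Sum of squared deviations from the mean. -/
noncomputable def sqErr (ys : List ℕ) : ℝ := (ys.map fun y => ((y : ℝ) - mean ys) ^ 2).sum

/-- Labels of the stream items `(x, y)` with `x ≤ j`. -/
def leftLabels (l : List (ℕ × ℕ)) (j : ℕ) : List ℕ :=
  (l.filter fun p => p.1 ≤ j).map Prod.snd

/-- Labels of the stream items `(x, y)` with `x > j`. -/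
def rightLabels (l : List (ℕ × ℕ)) (j : ℕ) : List ℕ :=
  (l.filter fun p => j < p.1).map Prod.snd

/-- The mean squared loss of the split `j` on the stream `l`. -/
noncomputable def splitLoss (l : List (ℕ × ℕ)) (j : ℕ) : ℝ :=
  (1 / (l.length : ℝ)) * (sqErr (leftLabels l j) + sqErr (rightLabels l j))

/-- The optimal loss over the splits `0, 1, …, N`. -/
noncomputable def optLoss (N : ℕ) (l : List (ℕ × ℕ)) : ℝ :=
  (Finset.range (N + 1)).inf' ⟨0, by simp⟩ (splitLoss l)

/-! ### A randomized random access machine with logarithmic (bit) costs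

Memory is an array of cells, indexed by natural numbers and holding natural numbers, all but
finitely many of them `0`. Everything is charged by bit length. -/

/-- Memory contents. -/
abbrev Mem := ℕ →₀ ℕ

/-- Number of bits of a memory: for every nonzero cell, the bits of its address and of its
content. -/
def space (m : Mem) : ℕ := ∑ a ∈ m.support, (a.size + (m a).size)

/-- Arithmetic expressions; `get a` is the content of the cell whose address is the value
of `a`. Subtraction is truncated at `0`, and division and remainder are those of `ℕ`. -/
inductive Expr where
  | const (n : ℕ)
  | get (a : Expr)
  | add (a b : Expr)
  | sub (a b : Expr)
  | mul (a b : Expr)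
  | div (a b : Expr)
  | mod (a b : Expr)

/-- Value of an expression. -/
def Expr.val (m : Mem) : Expr → ℕ
  | .const n => n
  | .get a => m (a.val m)
  | .add a b => a.val m + b.val m
  | .sub a b => a.val m - b.val m
  | .mul a b => a.val m * b.val m
  | .div a b => a.val m / b.val m
  | .mod a b => a.val m % b.val m

/-- Cost of evaluating an expression: one plus the bit length of the value, summed over all
subexpressions. -/
def Expr.cost (m : Mem) : Expr → ℕ
  | .const n => 1 + n.size
  | .get a => 1 + (m (a.val m)).size + a.cost m
  | .add a b => 1 + (a.val m + b.val m).size + a.cost m + b.cost m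
  | .sub a b => 1 + (a.val m - b.val m).size + a.cost m + b.cost m
  | .mul a b => 1 + (a.val m * b.val m).size + a.cost m + b.cost m
  | .div a b => 1 + (a.val m / b.val m).size + a.cost m + b.cost m
  | .mod a b => 1 + (a.val m % b.val m).size + a.cost m + b.cost m

/-- Programs. `set a e` writes the value of `e` into the cell with address `a`; `rand a e` writes
into that cell a fresh uniformly random element of `{0, …, e}`; tests are `e ≠ 0`. -/
inductive Prog where
  | skip
  | set (a e : Expr)
  | rand (a e : Expr)
  | seq (b c : Prog)
  | ite (e : Expr) (b c : Prog)
  | loop (e : Expr) (b : Prog)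

/-- A memory together with the resources used so far. -/
structure State where
  /-- the memory -/
  mem : Mem
  /-- time since the start of the current phase (initialization, one update, or query) -/
  time : ℕ
  /-- the largest number of bits in use at any moment so far -/
  peak : ℕ
  /-- the largest time that a completed update has taken so far -/
  slowest : ℕ

/-- Carry out one instruction whose expressions cost `k` and after which the memory is `m`.
The temporary values occurring in the evaluation are charged to the space. -/
def State.tick (s : State) (k : ℕ) (m : Mem) : State :=
  { s with
    mem := m
    time := s.time + 1 + k
    peak := max s.peak (max (space s.mem + k) (space m)) }

/-- `Exec c s p`: the program `c`, started in state `s`, halts for every outcome of its random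
choices, and `p` is the distribution of its final state. -/
inductive Exec : Prog → State → PMF State → Prop where
  | skip (s : State) : Exec .skip s (PMF.pure s)
  | set (a e : Expr) (s : State) :
      Exec (.set a e) s (PMF.pure
        (s.tick (a.cost s.mem + e.cost s.mem) (s.mem.update (a.val s.mem) (e.val s.mem))))
  | rand (a e : Expr) (s : State) :
      Exec (.rand a e) s ((PMF.uniformOfFintype (Fin (e.val s.mem + 1))).map fun i =>
        s.tick (a.cost s.mem + e.cost s.mem) (s.mem.update (a.val s.mem) (i : ℕ)))
  | seq {b c : Prog} {s : State} {p : PMF State} {q : State → PMF State} :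
      Exec b s p → (∀ t ∈ p.support, Exec c t (q t)) → Exec (.seq b c) s (p.bind q)
  | iteTrue {e : Expr} {b c : Prog} {s : State} {p : PMF State} :
      e.val s.mem ≠ 0 → Exec b (s.tick (e.cost s.mem) s.mem) p → Exec (.ite e b c) s p
  | iteFalse {e : Expr} {b c : Prog} {s : State} {p : PMF State} :
      e.val s.mem = 0 → Exec c (s.tick (e.cost s.mem) s.mem) p → Exec (.ite e b c) s p
  | loopStop {e : Expr} {b : Prog} {s : State} :
      e.val s.mem = 0 → Exec (.loop e b) s (PMF.pure (s.tick (e.cost s.mem) s.mem))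
  | loopStep {e : Expr} {b : Prog} {s : State} {p : PMF State} {q : State → PMF State} :
      e.val s.mem ≠ 0 → Exec b (s.tick (e.cost s.mem) s.mem) p →
      (∀ t ∈ p.support, Exec (.loop e b) t (q t)) → Exec (.loop e b) s (p.bind q)

/-! ### One-pass streaming algorithms -/

/-- A one-pass streaming algorithm: a program run once before the stream, a program run on the
arrival of every item, and a program run after the end of the stream. The three share the
memory, which is all that is carried from one to the next. -/
structure Algorithm where
  /-- run before the first item -/
  init : Prog
  /-- run on every item -/
  update : Prog
  /-- run after the last item -/
  query : Prog

/-- Start: the parameters `N`, `M`, `k` are in the cells `0`, `1`, `2`, all else is `0`. -/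
noncomputable def startState (N M k : ℕ) : State :=
  let m : Mem := (((0 : Mem).update 0 N).update 1 M).update 2 k
  { mem := m, time := 0, peak := space m, slowest := 0 }

/-- Arrival of the item `(x, y)`: it is put into the cells `0` and `1`, and the clock of the
update is started. -/
noncomputable def State.arrive (s : State) (p : ℕ × ℕ) : State :=
  let m : Mem := (s.mem.update 0 p.1).update 1 p.2
  { s with mem := m, time := 0, peak := max s.peak (space m) }

/-- End of an update: its time is recorded. -/
def State.finish (s : State) : State := { s with slowest := max s.slowest s.time }

/-- `Feed c l s p`: the items of `l` arrive one after the other, each is processed by `c`; the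
state is `s` at the beginning and has distribution `p` at the end. -/
inductive Feed (c : Prog) : List (ℕ × ℕ) → State → PMF State → Prop where
  | nil (s : State) : Feed c [] s (PMF.pure s)
  | cons {a : ℕ × ℕ} {l : List (ℕ × ℕ)} {s : State} {p : PMF State} {q : State → PMF State} :
      Exec c (s.arrive a) p → (∀ t ∈ p.support, Feed c l t.finish (q t)) →
      Feed c (a :: l) s (p.bind q)

/-- `A.Runs N M k l P`: on the parameters `N`, `M`, `k` and the stream `l`, the algorithm always
halts, and `P` is the distribution of the final state. The length of `l` is not an input. -/
def Algorithm.Runs (A : Algorithm) (N M k : ℕ) (l : List (ℕ × ℕ)) (P : PMF State) : Prop :=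
  ∃ (p : PMF State) (q r : State → PMF State),
    Exec A.init (startState N M k) p ∧
    (∀ s ∈ p.support, Feed A.update l s (q s)) ∧
    (∀ s ∈ (p.bind q).support, Exec A.query { s with time := 0 } (r s)) ∧
    P = (p.bind q).bind r

/-- The output is the content of the cell `0`. -/
def State.output (s : State) : ℕ := s.mem 0

end SplitStream

namespace SplitStream

/-! ### Bit costs of expressions -/

/-! The algorithm is deterministic, so every distribution is a point mass and the success
probability is one. Put a binary tree with `2 ^ H > N` leaves, `H = N.size`, over the positions.
Each item is counted at the highest ancestor of its leaf whose count, after insertion, is at most `1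
/ K` of the current length, where `K` is about `2 (H + 1) M² / ε`; leaves accept everything.
Afterwards an item is treated as if it lay at the left end of its node's interval.

Accuracy. For a split `j`, only items whose node's interval contains both `j` and the position `x >
j` change sides. These nodes are among the `H` internal ancestors of the leaf of `j`, each with at
most `m / K` items (`straddling_mul_le`). Adding an item to a list raises its squared error by at
most `M²`, so the total error changes by at most `ε m / 2` (`abs_splitErr_sub_le`). Minimizing the
rounded error therefore loses at most `ε` (`splitLoss_le`). The sum of all `y²` is common to all
splits, so counts and label sums suffice to find the minimum (`roundedErr_eq`).

Space. A node that comes into use, other than the root, has a parent that was full at that moment.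
While the length doubles, only `O(K)` parents can hold that many items, so `O(K)` nodes are added
per doubling and `O(K log m)` in total (`Placed.card_usedNodes_le`).

Machine costs. If all cells stay below `V`, an instruction costs at most a constant times the bit
length of `V`, so it is enough to count instructions and nonzero cells. The predicate `Wp` does
this; `wp_init`, `wp_update` and `wp_query` verify the programs, `feed_update` follows the stream,
and `resources_le` turns the counts into the stated bounds with `V` polynomial in the parameters. -/

/-- Exponent `d` such that the value is at most `V ^ d` when all cells are at most `V`. -/
def Expr.deg : Expr → ℕ
  | .const n => n
  | .get _ => 1
  | .add a b => a.deg + b.deg + 1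
  | .sub a _ => a.deg
  | .mul a b => a.deg + b.deg
  | .div a _ => a.deg
  | .mod a _ => a.deg

/-- Factor `w` such that the cost is at most `w * V.size` when all cells are at most `V`. -/
def Expr.weight : Expr → ℕ
  | .const n => n + 2
  | .get a => 3 + a.weight
  | .add a b => a.deg + b.deg + 3 + a.weight + b.weight
  | .sub a b => a.deg + 2 + a.weight + b.weight
  | .mul a b => a.deg + b.deg + 2 + a.weight + b.weight
  | .div a b => a.deg + 2 + a.weight + b.weight
  | .mod a b => a.deg + 2 + a.weight + b.weight

/-- Since `2 ≤ V`, a constant satisfies `n ≤ 2 ^ n ≤ V ^ n`, and an addition costs at most one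
further factor `V`. -/
theorem Expr.val_le_pow {V : ℕ} {m : Mem} (hV : 2 ≤ V) (hm : ∀ a, m a ≤ V) (e : Expr) :
    e.val m ≤ V ^ e.deg := by
  induction e with
  | const n => exact n.lt_two_pow_self.le.trans (Nat.pow_le_pow_left hV n)
  | get a => simpa [Expr.val, Expr.deg] using hm _
  | add a b iha ihb =>
    have h1 : V ^ a.deg ≤ V ^ (a.deg + b.deg) := Nat.pow_le_pow_right (by omega) (by omega)
    have h2 : V ^ b.deg ≤ V ^ (a.deg + b.deg) := Nat.pow_le_pow_right (by omega) (by omega)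
    calc a.val m + b.val m ≤ V ^ (a.deg + b.deg) * 2 := by omega
      _ ≤ V ^ (a.deg + b.deg) * V := Nat.mul_le_mul_left _ hV
      _ = V ^ (a.deg + b.deg + 1) := (pow_succ _ _).symm
  | sub a b iha ihb => exact (Nat.sub_le _ _).trans iha
  | mul a b iha ihb =>
    calc a.val m * b.val m ≤ V ^ a.deg * V ^ b.deg := Nat.mul_le_mul iha ihb
      _ = V ^ (a.deg + b.deg) := (pow_add _ _ _).symm
  | div a b iha ihb => exact (Nat.div_le_self _ _).trans iha
  | mod a b iha ihb => exact (Nat.mod_le _ _).trans iha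

theorem size_le_of_le_pow {V d n : ℕ} (hV : 2 ≤ V) (h : n ≤ V ^ d) :
    1 + n.size ≤ (d + 2) * V.size := by
  have hs : 1 ≤ V.size := Nat.size_pos.2 (by omega)
  have h1 : n < 2 ^ (V.size * d + 1) := by
    calc n ≤ V ^ d := h
      _ ≤ (2 ^ V.size) ^ d := Nat.pow_le_pow_left V.lt_size_self.le d
      _ = 2 ^ (V.size * d) := (pow_mul _ _ _).symm
      _ < 2 ^ (V.size * d + 1) := Nat.pow_lt_pow_right (by omega) (by omega)
  have := Nat.size_le.2 h1
  nlinarith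

theorem Expr.cost_le {V : ℕ} {m : Mem} (hV : 2 ≤ V) (hm : ∀ a, m a ≤ V) (e : Expr) :
    e.cost m ≤ e.weight * V.size := by
  have key := fun e : Expr => size_le_of_le_pow hV (e.val_le_pow hV hm)
  induction e with
  | const n => exact key (.const n)
  | get a iha =>
    have := key (.get a)
    simp only [Expr.val, Expr.deg] at this
    simp only [Expr.cost, Expr.weight]; linarith
  | add a b iha ihb =>
    have := key (.add a b)
    simp only [Expr.val, Expr.deg] at this
    simp only [Expr.cost, Expr.weight]; linarith
  | sub a b iha ihb =>
    have := key (.sub a b)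
    simp only [Expr.val, Expr.deg] at this
    simp only [Expr.cost, Expr.weight]; linarith
  | mul a b iha ihb =>
    have := key (.mul a b)
    simp only [Expr.val, Expr.deg] at this
    simp only [Expr.cost, Expr.weight]; linarith
  | div a b iha ihb =>
    have := key (.div a b)
    simp only [Expr.val, Expr.deg] at this
    simp only [Expr.cost, Expr.weight]; linarith
  | mod a b iha ihb =>
    have := key (.mod a b)
    simp only [Expr.val, Expr.deg] at this
    simp only [Expr.cost, Expr.weight]; linarith

/-! ### Runs of deterministic programs with resource bounds -/

theorem Exec.seq_pure {b c : Prog} {s t u : State} (hb : Exec b s (PMF.pure t))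
    (hc : Exec c t (PMF.pure u)) : Exec (.seq b c) s (PMF.pure u) := by
  have := Exec.seq (q := fun _ => PMF.pure u) hb (by simpa using hc)
  rwa [PMF.pure_bind] at this

theorem Exec.loop_pure {e : Expr} {b : Prog} {s t u : State} (he : e.val s.mem ≠ 0)
    (hb : Exec b (s.tick (e.cost s.mem) s.mem) (PMF.pure t))
    (hc : Exec (.loop e b) t (PMF.pure u)) : Exec (.loop e b) s (PMF.pure u) := by
  have := Exec.loopStep (q := fun _ => PMF.pure u) he hb (by simpa using hc)
  rwa [PMF.pure_bind] at this

/-- All nonzero cells of `m` lie in the set `R` of at most `n` addresses, and all contents and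
these addresses are at most `V`. -/
structure Fits (V n : ℕ) (R : Finset ℕ) (m : Mem) : Prop where
  two_le : 2 ≤ V
  card_le : R.card ≤ n
  addr_le : ∀ a ∈ R, a ≤ V
  val_le : ∀ a, m a ≤ V
  supp : ∀ a, m a ≠ 0 → a ∈ R

theorem Fits.space_le {V n : ℕ} {R : Finset ℕ} {m : Mem} (h : Fits V n R m) :
    space m ≤ 2 * n * V.size := by
  have hsub : m.support ⊆ R := fun a ha => h.supp a (Finsupp.mem_support_iff.1 ha)
  calc space m ≤ ∑ a ∈ m.support, 2 * V.size := by
        refine Finset.sum_le_sum fun a ha => ?_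
        have h1 := Nat.size_le_size (h.addr_le a (hsub ha))
        have h2 := Nat.size_le_size (h.val_le a)
        omega
    _ = m.support.card * (2 * V.size) := by simp
    _ ≤ n * (2 * V.size) :=
        Nat.mul_le_mul_right _ ((Finset.card_le_card hsub).trans h.card_le)
    _ = 2 * n * V.size := by ring

theorem Fits.update {V n : ℕ} {R : Finset ℕ} {m : Mem} (h : Fits V n R m) {a v : ℕ}
    (ha : a ∈ R) (hv : v ≤ V) : Fits V n R (m.update a v) := by
  refine ⟨h.two_le, h.card_le, h.addr_le, fun b => ?_, fun b hb => ?_⟩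
  · rw [Finsupp.coe_update, Function.update_apply]
    split_ifs
    exacts [hv, h.val_le b]
  · rw [Finsupp.coe_update, Function.update_apply] at hb
    split_ifs at hb with hba
    exacts [hba ▸ ha, h.supp b hb]

theorem Fits.mono {V n : ℕ} {R R' : Finset ℕ} {m : Mem} (h : Fits V n R m) (hs : R ⊆ R')
    (hc : R'.card ≤ n) (ha : ∀ a ∈ R', a ≤ V) : Fits V n R' m :=
  ⟨h.two_le, hc, ha, h.val_le, fun a h0 => hs (h.supp a h0)⟩

/-- `Wp V n W R c m k Q`: started with the memory `m`, if it fits, `c` halts after at most `k`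
instructions of weight at most `W` with a memory that fits and satisfies `Q`. -/
def Wp (V n W : ℕ) (R : Finset ℕ) (c : Prog) (m : Mem) (k : ℕ) (Q : Mem → Prop) : Prop :=
  Fits V n R m → ∃ m', Fits V n R m' ∧ Q m' ∧ ∀ s : State, s.mem = m →
    ∃ s', Exec c s (PMF.pure s') ∧ s'.mem = m' ∧ s'.slowest = s.slowest ∧
      s'.time ≤ s.time + k * (1 + W * V.size) ∧
      s'.peak ≤ max s.peak ((2 * n + W) * V.size)

section Rules

variable {V n W : ℕ} {R : Finset ℕ} {m : Mem} {k : ℕ} {Q : Mem → Prop}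

theorem Wp.mono {c : Prog} {k' : ℕ} {Q' : Mem → Prop} (h : Wp V n W R c m k Q) (hk : k ≤ k')
    (hQ : ∀ m', Fits V n R m' → Q m' → Q' m') : Wp V n W R c m k' Q' := by
  intro hf
  obtain ⟨m', hf', hq, hr⟩ := h hf
  refine ⟨m', hf', hQ m' hf' hq, fun s hs => ?_⟩
  obtain ⟨s', h1, h2, h3, h4, h5⟩ := hr s hs
  exact ⟨s', h1, h2, h3, h4.trans (by gcongr), h5⟩

theorem Wp.skip (hQ : Q m) : Wp V n W R .skip m k Q := by
  intro hf
  exact ⟨m, hf, hQ, fun s hs => ⟨s, Exec.skip s, hs, rfl, by omega, le_max_left _ _⟩⟩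

theorem tick_bounds {s : State} {e : ℕ} {m : Mem} (hs : Fits V n R s.mem) (hm : Fits V n R m)
    (he : e ≤ W * V.size) :
    (s.tick e m).time ≤ s.time + (1 + W * V.size) ∧
      (s.tick e m).peak ≤ max s.peak ((2 * n + W) * V.size) := by
  have h1 := hs.space_le
  have h2 := hm.space_le
  have h3 : (2 * n + W) * V.size = 2 * n * V.size + W * V.size := add_mul _ _ _
  refine ⟨by simp only [State.tick]; omega, ?_⟩
  simp only [State.tick]
  omega

theorem Wp.set {a e : Expr} (hW : a.weight + e.weight ≤ W) (ha : a.val m ∈ R)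
    (he : e.val m ≤ V) (hQ : Q (m.update (a.val m) (e.val m))) :
    Wp V n W R (.set a e) m 1 Q := by
  intro hf
  have hf' := hf.update ha he
  refine ⟨_, hf', hQ, fun s hs => ⟨_, Exec.set a e s, ?_, rfl, ?_⟩⟩
  · simp [State.tick, hs]
  · subst hs
    have hc : a.cost s.mem + e.cost s.mem ≤ W * V.size := by
      have h1 := a.cost_le hf.two_le hf.val_le
      have h2 := e.cost_le hf.two_le hf.val_le
      have h3 := Nat.mul_le_mul_right V.size hW
      rw [add_mul] at h3
      omega
    simpa using tick_bounds hf hf' hc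

theorem Wp.assign {a e : Expr} {r v : ℕ} (hW : a.weight + e.weight ≤ W) (hr : a.val m = r)
    (hv : e.val m = v) (hR : r ∈ R) (hV : v ≤ V)
    (hQ : ∀ m' : Mem, m' r = v → (∀ b, b ≠ r → m' b = m b) → Q m') :
    Wp V n W R (.set a e) m 1 Q := by
  subst hr hv
  refine Wp.set hW hR hV (hQ _ ?_ fun b hb => ?_)
  · simp
  · rw [Finsupp.coe_update, Function.update_of_ne hb]

/-- In `Wp` the final memory is chosen before the state, hence independently of the counters; this
lets the two runs be chained. Times add up, while the peak bound is the same for both. -/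
theorem Wp.seq {b c : Prog} {k₁ k₂ : ℕ} (h : Wp V n W R b m k₁ fun m' => Wp V n W R c m' k₂ Q) :
    Wp V n W R (.seq b c) m (k₁ + k₂) Q := by
  intro hf
  obtain ⟨m₁, hf₁, h₁, hr₁⟩ := h hf
  obtain ⟨m₂, hf₂, h₂, hr₂⟩ := h₁ hf₁
  refine ⟨m₂, hf₂, h₂, fun s hs => ?_⟩
  obtain ⟨s₁, e₁, q₁, l₁, t₁, p₁⟩ := hr₁ s hs
  obtain ⟨s₂, e₂, q₂, l₂, t₂, p₂⟩ := hr₂ s₁ q₁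
  refine ⟨s₂, e₁.seq_pure e₂, q₂, l₂.trans l₁, ?_, ?_⟩
  · rw [add_mul]; omega
  · omega

/-- Common to both branches of a conditional and to leaving a loop: one tick that keeps the memory,
followed by `c`. -/
theorem Wp.test {e : Expr} {c c' : Prog} (hW : e.weight ≤ W)
    (hex : ∀ s t : State, s.mem = m → Exec c (s.tick (e.cost s.mem) s.mem) (PMF.pure t) →
      Exec c' s (PMF.pure t)) (h : Wp V n W R c m k Q) : Wp V n W R c' m (k + 1) Q := by
  intro hf
  obtain ⟨m', hf', hq, hr⟩ := h hf
  refine ⟨m', hf', hq, fun s hs => ?_⟩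
  have hc : e.cost s.mem ≤ W * V.size := by
    subst hs
    exact (e.cost_le hf.two_le hf.val_le).trans (Nat.mul_le_mul_right _ hW)
  have hb := tick_bounds (hs ▸ hf : Fits V n R s.mem) (hs ▸ hf : Fits V n R s.mem) hc
  obtain ⟨s', h1, h2, h3, h4, h5⟩ := hr (s.tick (e.cost s.mem) s.mem) (by simpa [State.tick])
  refine ⟨s', hex s s' hs h1, h2, by simpa [State.tick] using h3, ?_, ?_⟩
  · rw [add_mul]; omega
  · omega

theorem Wp.ite {e : Expr} {b c : Prog} (hW : e.weight ≤ W)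
    (hb : e.val m ≠ 0 → Wp V n W R b m k Q) (hc : e.val m = 0 → Wp V n W R c m k Q) :
    Wp V n W R (.ite e b c) m (k + 1) Q := by
  by_cases he : e.val m = 0
  · exact Wp.test hW (fun s t hs h => Exec.iteFalse (by rwa [hs]) h) (hc he)
  · exact Wp.test hW (fun s t hs h => Exec.iteTrue (by rwa [hs]) h) (hb he)

theorem Wp.loop_stop {e : Expr} {b : Prog} (hW : e.weight ≤ W) (he : e.val m = 0) (hQ : Q m) :
    Wp V n W R (.loop e b) m 1 Q := by
  refine Wp.test (c := .skip) (k := 0) hW (fun s t hs h => ?_) (Wp.skip hQ)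
  generalize hp : PMF.pure t = p at h
  generalize hu : s.tick (e.cost s.mem) s.mem = u at h
  cases h with
  | skip =>
    subst hu
    exact Exec.loopStop (by rwa [hs])

theorem Wp.loop_step {e : Expr} {b : Prog} {k₁ k₂ : ℕ} (hW : e.weight ≤ W) (he : e.val m ≠ 0)
    (h : Wp V n W R b m k₁ fun m' => Wp V n W R (.loop e b) m' k₂ Q) :
    Wp V n W R (.loop e b) m (k₁ + 1 + k₂) Q := by
  intro hf
  obtain ⟨m₁, hf₁, h₁, hr₁⟩ := h hf
  obtain ⟨m₂, hf₂, h₂, hr₂⟩ := h₁ hf₁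
  refine ⟨m₂, hf₂, h₂, fun s hs => ?_⟩
  have hc : e.cost s.mem ≤ W * V.size := by
    subst hs
    exact (e.cost_le hf.two_le hf.val_le).trans (Nat.mul_le_mul_right _ hW)
  have hb := tick_bounds (hs ▸ hf : Fits V n R s.mem) (hs ▸ hf : Fits V n R s.mem) hc
  obtain ⟨s₁, e₁, q₁, l₁, t₁, p₁⟩ := hr₁ (s.tick (e.cost s.mem) s.mem) (by simpa [State.tick])
  obtain ⟨s₂, e₂, q₂, l₂, t₂, p₂⟩ := hr₂ s₁ q₁
  refine ⟨s₂, Exec.loop_pure (by rwa [hs]) e₁ e₂, q₂,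
    l₂.trans (l₁.trans (by simp [State.tick])), ?_, ?_⟩
  · rw [add_mul, add_mul]; omega
  · omega

/-- A loop with invariant `I i`, where `i` decreases in every iteration. -/
theorem Wp.loop {e : Expr} {b : Prog} {I : ℕ → Mem → Prop} (hW : e.weight ≤ W)
    (hstep : ∀ i m, I i m → e.val m ≠ 0 → ∃ i', i = i' + 1 ∧ Wp V n W R b m k (I i'))
    {i : ℕ} (hI : I i m) :
    Wp V n W R (.loop e b) m ((k + 1) * i + 1) fun m' => (∃ i', I i' m') ∧ e.val m' = 0 := by
  induction i generalizing m with
  | zero =>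
    by_cases he : e.val m = 0
    · exact Wp.loop_stop hW he ⟨⟨0, hI⟩, he⟩
    · obtain ⟨i', hi, -⟩ := hstep 0 m hI he
      omega
  | succ i ih =>
    by_cases he : e.val m = 0
    · exact (Wp.loop_stop hW he ⟨⟨_, hI⟩, he⟩).mono (by omega) fun _ _ h => h
    · obtain ⟨i', hi, h⟩ := hstep _ m hI he
      obtain rfl : i = i' := by omega
      refine (Wp.loop_step (k₂ := (k + 1) * i + 1) hW he (h.mono le_rfl fun _ _ => ih)).mono ?_
        fun _ _ h => h
      rw [Nat.mul_succ]; omega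

end Rules

/-! ### Dyadic placement of the items

A placed item `(h, x, y)` is an item `(x, y)` that is stored at the ancestor of height `h` of the
leaf `P + x` of the binary tree with root `1` and `P = 2 ^ H` leaves. -/

/-- The tree node that stores a placed item. -/
def node (P : ℕ) (i : ℕ × ℕ × ℕ) : ℕ := (P + i.2.1) / 2 ^ i.1

/-- The left end of the dyadic interval that belongs to the node of a placed item. -/
def leftEnd (i : ℕ × ℕ × ℕ) : ℕ := i.2.1 - i.2.1 % 2 ^ i.1

/-- The number of items stored at the node `v`. -/
def nodeCount (P : ℕ) (w : List (ℕ × ℕ × ℕ)) (v : ℕ) : ℕ := w.countP fun i => node P i = v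

/-- The placed items, latest first, are such that each was stored at the highest ancestor whose
count after the insertion is at most the fraction `1 / K` of the current stream length, or at its
leaf. -/
inductive Placed (P K H : ℕ) : List (ℕ × ℕ × ℕ) → Prop where
  | nil : Placed P K H []
  | cons {w : List (ℕ × ℕ × ℕ)} {h x y : ℕ} : Placed P K H w → h ≤ H → x < P →
      (h = 0 ∨ (nodeCount P w ((P + x) / 2 ^ h) + 1) * K ≤ w.length + 1) →
      (∀ h', h < h' → h' ≤ H → w.length + 1 < (nodeCount P w ((P + x) / 2 ^ h') + 1) * K) →
      Placed P K H ((h, x, y) :: w)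

theorem nodeCount_cons (P : ℕ) (i : ℕ × ℕ × ℕ) (w : List (ℕ × ℕ × ℕ)) (v : ℕ) :
    nodeCount P (i :: w) v = nodeCount P w v + if node P i = v then 1 else 0 := by
  simp [nodeCount, List.countP_cons]

theorem Placed.of_append {P K H : ℕ} {w₂ w₁ : List (ℕ × ℕ × ℕ)} (h : Placed P K H (w₂ ++ w₁)) :
    Placed P K H w₁ := by
  induction w₂ with
  | nil => exact h
  | cons i w ih =>
    cases h with
    | cons h _ _ _ _ => exact ih h

/-- Room is tested whenever the count of an internal node grows, and the bound survives later items
because the length only increases. Leaves have numbers at least `P` and are exempt. -/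
theorem Placed.nodeCount_mul_le {P K H : ℕ} {w : List (ℕ × ℕ × ℕ)} (hw : Placed P K H w) {v : ℕ}
    (hv : v < P) : nodeCount P w v * K ≤ w.length := by
  induction hw with
  | nil => simp [nodeCount]
  | @cons w h x y hw hh hx hfit _ ih =>
    rw [nodeCount_cons, List.length_cons]
    split_ifs with hn
    · rcases hfit with rfl | hfit
      · simp [node] at hn
        omega
      · rw [← hn]
        exact hfit
    · rw [add_zero]; omega

/-- Number of items with `x > j` whose node starts at or before `j`. -/
def straddling (w : List (ℕ × ℕ × ℕ)) (j : ℕ) : ℕ :=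
  w.countP fun i => leftEnd i ≤ j ∧ j < i.2.1

/-- The interval of the node contains `x` and starts at or before `j < x`, so it contains `j`: the
two leaves share this ancestor. -/
theorem node_eq_of_straddling {H h x y j : ℕ} (hh : h ≤ H) (h1 : leftEnd (h, x, y) ≤ j)
    (h2 : j < x) : node (2 ^ H) (h, x, y) = (2 ^ H + j) / 2 ^ h := by
  obtain ⟨q, hq⟩ := pow_dvd_pow 2 hh
  have hpos : 0 < 2 ^ h := by positivity
  simp only [node, leftEnd] at *
  rw [hq, Nat.mul_add_div hpos, Nat.mul_add_div hpos]
  congr 1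
  apply le_antisymm _ (Nat.div_le_div_right h2.le)
  rw [Nat.le_div_iff_mul_le hpos]
  have := Nat.div_add_mod x (2 ^ h)
  rw [mul_comm]
  omega

/-- Each straddling item is charged to the ancestor of the leaf of `j` at its own height. Height `0`
does not occur, since an item stored at its leaf is not moved by rounding. -/
theorem straddling_le_sum {K H : ℕ} {w : List (ℕ × ℕ × ℕ)} (hw : Placed (2 ^ H) K H w) (j : ℕ) :
    straddling w j ≤ ∑ h ∈ Finset.Icc 1 H, nodeCount (2 ^ H) w ((2 ^ H + j) / 2 ^ h) := by
  induction hw with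
  | nil => simp [straddling]
  | @cons w h x y hw hh hx _ _ ih =>
    simp only [nodeCount_cons, Finset.sum_add_distrib]
    simp only [straddling, List.countP_cons, decide_eq_true_eq] at ih ⊢
    split_ifs with hs
    · refine Nat.add_le_add ih ?_
      have h0 : h ≠ 0 := by
        rintro rfl
        simp only [leftEnd, pow_zero, Nat.mod_one] at hs
        omega
      rw [← Finset.add_sum_erase _ _ (Finset.mem_Icc.2 ⟨Nat.one_le_iff_ne_zero.2 h0, hh⟩),
        if_pos (node_eq_of_straddling hh hs.1 hs.2)]
      omega
    · omega

theorem straddling_mul_le {K H : ℕ} {w : List (ℕ × ℕ × ℕ)} (hw : Placed (2 ^ H) K H w) {j : ℕ}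
    (hj : j < 2 ^ H) : straddling w j * K ≤ H * w.length := by
  calc straddling w j * K
      ≤ (∑ h ∈ Finset.Icc 1 H, nodeCount (2 ^ H) w ((2 ^ H + j) / 2 ^ h)) * K :=
        Nat.mul_le_mul_right _ (straddling_le_sum hw j)
    _ = ∑ h ∈ Finset.Icc 1 H, nodeCount (2 ^ H) w ((2 ^ H + j) / 2 ^ h) * K :=
        Finset.sum_mul _ _ _
    _ ≤ ∑ h ∈ Finset.Icc 1 H, w.length := by
        refine Finset.sum_le_sum fun h hh => hw.nodeCount_mul_le ?_
        have h2 : 2 ^ 1 ≤ 2 ^ h := Nat.pow_le_pow_right (by omega) (Finset.mem_Icc.1 hh).1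
        rw [Nat.div_lt_iff_lt_mul (by positivity)]
        nlinarith
    _ = H * w.length := by simp

/-! ### The number of nodes in use -/

/-- The nodes that store at least one item. -/
def usedNodes (P : ℕ) (w : List (ℕ × ℕ × ℕ)) : Finset ℕ := (w.map (node P)).toFinset

theorem card_usedNodes_le_length (P : ℕ) (w : List (ℕ × ℕ × ℕ)) :
    (usedNodes P w).card ≤ w.length :=
  (List.toFinset_card_le _).trans (by simp)

theorem nodeCount_le_cons (P : ℕ) (i : ℕ × ℕ × ℕ) (w : List (ℕ × ℕ × ℕ)) (v : ℕ) :
    nodeCount P w v ≤ nodeCount P (i :: w) v := by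
  rw [nodeCount_cons]; omega

theorem sum_nodeCount_le (P : ℕ) (w : List (ℕ × ℕ × ℕ)) (F : Finset ℕ) :
    ∑ u ∈ F, nodeCount P w u ≤ w.length := by
  induction w with
  | nil => simp [nodeCount]
  | cons i w ih =>
    simp only [nodeCount_cons, Finset.sum_add_distrib, Finset.sum_ite_eq, List.length_cons]
    split_ifs <;> omega

/-- The first item stored at `v` after `w₁` was refused by the parent `v / 2`, which was full for a
length exceeding that of `w₁`; counts never decrease. The root has no parent. -/
theorem Placed.mem_usedNodes {K H : ℕ} {w₂ w₁ : List (ℕ × ℕ × ℕ)}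
    (hw : Placed (2 ^ H) K H (w₂ ++ w₁)) {v : ℕ} (hv : v ∈ usedNodes (2 ^ H) (w₂ ++ w₁)) :
    v ∈ usedNodes (2 ^ H) w₁ ∨ v = 1 ∨
      w₁.length < (nodeCount (2 ^ H) (w₂ ++ w₁) (v / 2) + 1) * K := by
  induction w₂ with
  | nil => exact Or.inl hv
  | cons i w ih =>
    rw [List.cons_append] at hw hv ⊢
    have hmono := nodeCount_le_cons (2 ^ H) i (w ++ w₁) (v / 2)
    by_cases hold : v ∈ usedNodes (2 ^ H) (w ++ w₁)
    · cases hw with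
      | cons hw _ _ _ _ =>
        rcases ih hw hold with h | h | h
        · exact Or.inl h
        · exact Or.inr (Or.inl h)
        · exact Or.inr (Or.inr (h.trans_le (Nat.mul_le_mul_right _ (by omega))))
    · have hvi : v = node (2 ^ H) i := by
        simp only [usedNodes, List.map_cons, List.toFinset_cons, Finset.mem_insert] at hv hold
        tauto
      cases hw with
      | @cons _ h x y hw hh hx _ hfull =>
        right
        rcases hh.eq_or_lt with rfl | hlt
        · left
          -- At height `H` the node is the root, because `2 ^ H ≤ 2 ^ H + x < 2 * 2 ^ H`.
          exact hvi.trans (Nat.div_eq_of_lt_le (by simp) (by simp; omega))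
        · right
          have := hfull (h + 1) (by omega) (by omega)
          rw [pow_succ, ← Nat.div_div_eq_div_mul] at this
          change _ < (nodeCount _ _ (node (2 ^ H) (h, x, y) / 2) + 1) * K at this
          rw [← hvi, List.length_append] at this
          exact lt_of_lt_of_le (by omega) (this.le.trans (Nat.mul_le_mul_right _ (by omega)))

/-- With `T` the length of `w₁`, a parent in `F` has count `c ≥ 1` because `T ≥ 2 K`, so `T < (c +
1) K ≤ 2 K c`. At most `3 T` items exist, hence at most `6 K` such parents. Two children each and
the root give `12 K + 1 ≤ 13 K`. -/
theorem Placed.card_usedNodes_append_le {K H : ℕ} {w₂ w₁ : List (ℕ × ℕ × ℕ)}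
    (hw : Placed (2 ^ H) K H (w₂ ++ w₁)) (hK : 1 ≤ K) (h1 : 2 * K ≤ w₁.length)
    (h2 : (w₂ ++ w₁).length ≤ 2 * w₁.length + 1) :
    (usedNodes (2 ^ H) (w₂ ++ w₁)).card ≤ (usedNodes (2 ^ H) w₁).card + 13 * K := by
  set w := w₂ ++ w₁ with hw_def
  set T := w₁.length
  set F := (usedNodes (2 ^ H) w).filter fun u => T < (nodeCount (2 ^ H) w u + 1) * K with hF
  have hsub : usedNodes (2 ^ H) w ⊆
      usedNodes (2 ^ H) w₁ ∪ ({1} ∪ (F.image (2 * ·) ∪ F.image (2 * · + 1))) := by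
    intro v hv
    rcases hw.mem_usedNodes hv with h | h | h
    · simp [h]
    · simp [h]
    · have hu : v / 2 ∈ F := by
        refine Finset.mem_filter.2 ⟨?_, h⟩
        have hpos : 0 < nodeCount (2 ^ H) w (v / 2) := by
          by_contra h0
          simp only [not_lt, Nat.le_zero] at h0
          rw [← hw_def, h0] at h
          omega
        obtain ⟨i, hi, hiv⟩ := List.countP_pos_iff.1 hpos
        exact List.mem_toFinset.2 (List.mem_map.2 ⟨i, hi, by simpa using hiv⟩)
      rcases Nat.mod_two_eq_zero_or_one v with hm | hm
      · have : 2 * (v / 2) = v := by omega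
        simp only [Finset.mem_union, Finset.mem_image]
        exact Or.inr (Or.inr (Or.inl ⟨_, hu, this⟩))
      · have : 2 * (v / 2) + 1 = v := by omega
        simp only [Finset.mem_union, Finset.mem_image]
        exact Or.inr (Or.inr (Or.inr ⟨_, hu, this⟩))
  have hcard : F.card ≤ 6 * K := by
    have hsum : F.card * T ≤ 2 * K * w.length := by
      calc F.card * T = ∑ u ∈ F, T := by simp
        _ ≤ ∑ u ∈ F, 2 * K * nodeCount (2 ^ H) w u := by
            refine Finset.sum_le_sum fun u hu => ?_
            have := (Finset.mem_filter.1 hu).2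
            have hc : 1 ≤ nodeCount (2 ^ H) w u := by
              by_contra h0
              have h0 : nodeCount (2 ^ H) w u = 0 := by omega
              rw [h0] at this
              omega
            nlinarith
        _ = 2 * K * ∑ u ∈ F, nodeCount (2 ^ H) w u := (Finset.mul_sum _ _ _).symm
        _ ≤ 2 * K * w.length := Nat.mul_le_mul_left _ (sum_nodeCount_le _ _ _)
    have hT : 0 < T := by omega
    have : F.card * T ≤ 6 * K * T := by nlinarith
    exact Nat.le_of_mul_le_mul_right this hT
  calc (usedNodes (2 ^ H) w).card
      ≤ (usedNodes (2 ^ H) w₁).card + (1 + (F.card + F.card)) := by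
        refine (Finset.card_le_card hsub).trans ?_
        refine (Finset.card_union_le _ _).trans (Nat.add_le_add_left ?_ _)
        refine (Finset.card_union_le _ _).trans (Nat.add_le_add (by simp) ?_)
        exact (Finset.card_union_le _ _).trans
          (Nat.add_le_add Finset.card_image_le Finset.card_image_le)
    _ ≤ (usedNodes (2 ^ H) w₁).card + 13 * K := by omega

theorem Placed.card_usedNodes_le {K H : ℕ} {w : List (ℕ × ℕ × ℕ)} (hw : Placed (2 ^ H) K H w)
    (hK : 1 ≤ K) : (usedNodes (2 ^ H) w).card ≤ 13 * K * w.length.size := by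
  induction hn : w.length using Nat.strong_induction_on generalizing w with
  | _ n ih =>
    subst hn
    rcases Nat.eq_zero_or_pos w.length with h0 | hpos
    · exact (card_usedNodes_le_length _ _).trans (by omega)
    · have hsize : w.length.size = (w.length / 2).size + 1 := by
        conv_lhs => rw [← Nat.bit_bodd_div2 w.length]
        rw [Nat.size_bit (by rw [Nat.bit_bodd_div2]; omega), Nat.div2_val]
      by_cases hlong : 4 * K ≤ w.length
      · have hsplit := List.take_append_drop (w.length - w.length / 2) w
        rw [← hsplit] at hw
        have hlen : (w.drop (w.length - w.length / 2)).length = w.length / 2 := by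
          rw [List.length_drop]; omega
        have h1 := hw.card_usedNodes_append_le hK (by rw [hlen]; omega)
          (by rw [hsplit, hlen]; omega)
        have h2 := ih _ (by omega) hw.of_append hlen
        rw [hsplit] at h1
        rw [hsize, Nat.mul_succ]
        omega
      · have := card_usedNodes_le_length (2 ^ H) w
        rw [hsize]
        nlinarith [Nat.zero_le (13 * K * (w.length / 2).size)]

/-! ### Sums of squared deviations -/

theorem sum_sq_sub (ys : List ℕ) (c : ℝ) :
    (ys.map fun y : ℕ => ((y : ℝ) - c) ^ 2).sum =
      (ys.map fun y : ℕ => (y : ℝ) ^ 2).sum - 2 * c * (ys.map fun y : ℕ => (y : ℝ)).sum +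
        ys.length * c ^ 2 := by
  induction ys with
  | nil => simp
  | cons y ys ih =>
    simp only [List.map_cons, List.sum_cons, ih, List.length_cons]
    push_cast
    ring

theorem mean_eq (ys : List ℕ) : mean ys = (ys.sum : ℝ) / ys.length := by
  rw [mean, Nat.cast_list_sum]
  simp [List.map_eq_flatMap]

/-- Puts the cast of each label inside the mapped function, the form to which `sum_sq_sub` applies.
-/
theorem sqErr_eq_sum (ys : List ℕ) :
    sqErr ys = (ys.map fun y : ℕ => ((y : ℝ) - mean ys) ^ 2).sum := by
  simp [sqErr, List.map_eq_flatMap, List.flatMap_assoc]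

theorem sqErr_eq (ys : List ℕ) :
    sqErr ys = (ys.map fun y : ℕ => (y : ℝ) ^ 2).sum - (ys.sum : ℝ) ^ 2 / ys.length := by
  have hs : (ys.map fun y : ℕ => (y : ℝ)).sum = (ys.sum : ℝ) := by
    rw [Nat.cast_list_sum]
  rw [sqErr_eq_sum, sum_sq_sub, mean_eq, hs]
  rcases Nat.eq_zero_or_pos ys.length with h | h
  · simp [h]
  · have : (ys.length : ℝ) ≠ 0 := by positivity
    field_simp
    ring

/-- The mean minimizes the sum of squared deviations: for `n` labels with sum `s`, the excess at `c`
is `(s - n c)² / n`. -/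
theorem sqErr_le_sum (ys : List ℕ) (c : ℝ) :
    sqErr ys ≤ (ys.map fun y : ℕ => ((y : ℝ) - c) ^ 2).sum := by
  have hs : (ys.map fun y : ℕ => (y : ℝ)).sum = (ys.sum : ℝ) := by
    rw [Nat.cast_list_sum]
  rw [sqErr_eq, sum_sq_sub, hs]
  rcases Nat.eq_zero_or_pos ys.length with h | h
  · have h0 : ys = [] := List.eq_nil_of_length_eq_zero h
    simp [h0]
  · have hp : (0 : ℝ) < ys.length := by positivity
    have : 0 ≤ ((ys.sum : ℝ) - ys.length * c) ^ 2 / ys.length := by positivity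
    have he : ((ys.sum : ℝ) - ys.length * c) ^ 2 / ys.length =
        (ys.sum : ℝ) ^ 2 / ys.length - 2 * c * ys.sum + ys.length * c ^ 2 := by
      field_simp
      ring
    linarith

theorem sqErr_perm {ys zs : List ℕ} (h : ys.Perm zs) : sqErr ys = sqErr zs := by
  rw [sqErr_eq, sqErr_eq, (h.map _).sum_eq, h.sum_eq, h.length_eq]

theorem sqErr_le_cons (y : ℕ) (ys : List ℕ) : sqErr ys ≤ sqErr (y :: ys) := by
  refine (sqErr_le_sum ys (mean (y :: ys))).trans ?_
  rw [sqErr_eq_sum (y :: ys), List.map_cons, List.sum_cons]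
  have := sq_nonneg ((y : ℝ) - mean (y :: ys))
  linarith

theorem mean_mem {M : ℕ} {ys : List ℕ} (h : ∀ y ∈ ys, y ≤ M) : 0 ≤ mean ys ∧ mean ys ≤ M := by
  have h1 : ys.sum ≤ ys.length * M := by simpa using List.sum_le_card_nsmul ys M h
  have h2 : (ys.sum : ℝ) ≤ M * ys.length := by rw [mul_comm]; exact_mod_cast h1
  rw [mean_eq]
  exact ⟨by positivity, div_le_of_le_mul₀ (by positivity) (by positivity) h2⟩

/-- Keep the old mean as centre: it lies in `[0, M]`, so the new label contributes at most `M²`. -/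
theorem sqErr_cons_le {M y : ℕ} {ys : List ℕ} (hy : y ≤ M) (h : ∀ y ∈ ys, y ≤ M) :
    sqErr (y :: ys) ≤ sqErr ys + (M : ℝ) ^ 2 := by
  refine (sqErr_le_sum _ (mean ys)).trans ?_
  rw [List.map_cons, List.sum_cons, ← sqErr_eq_sum]
  obtain ⟨h1, h2⟩ := mean_mem h
  have hy' : (y : ℝ) ≤ M := by exact_mod_cast hy
  have : ((y : ℝ) - mean ys) ^ 2 ≤ (M : ℝ) ^ 2 :=
    sq_le_sq' (by linarith [(Nat.cast_nonneg y : (0 : ℝ) ≤ y)]) (by linarith)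
  linarith

theorem sqErr_append_bounds {M : ℕ} {ds ys : List ℕ} (hd : ∀ y ∈ ds, y ≤ M)
    (h : ∀ y ∈ ys, y ≤ M) :
    sqErr ys ≤ sqErr (ds ++ ys) ∧ sqErr (ds ++ ys) ≤ sqErr ys + ds.length * (M : ℝ) ^ 2 := by
  induction ds with
  | nil => simp
  | cons d ds ih =>
    obtain ⟨h1, h2⟩ := ih fun y hy => hd y (List.mem_cons_of_mem _ hy)
    have h3 := sqErr_le_cons d (ds ++ ys)
    have h4 : sqErr (d :: (ds ++ ys)) ≤ sqErr (ds ++ ys) + (M : ℝ) ^ 2 := by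
      refine sqErr_cons_le (hd d (by simp)) fun y hy => ?_
      rcases List.mem_append.1 hy with hy | hy
      exacts [hd y (by simp [hy]), h y hy]
    rw [List.cons_append, List.length_cons]
    push_cast
    constructor <;> nlinarith

/-! ### The loss after rounding the items down -/

/-- Labels of the placed items whose node starts at or before `j`. -/
def lowLabels (w : List (ℕ × ℕ × ℕ)) (j : ℕ) : List ℕ :=
  (w.filter fun i => leftEnd i ≤ j).map fun i => i.2.2

/-- Labels of the placed items whose node starts after `j`. -/
def highLabels (w : List (ℕ × ℕ × ℕ)) (j : ℕ) : List ℕ :=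
  (w.filter fun i => ¬ leftEnd i ≤ j).map fun i => i.2.2

/-- Total squared error of the split `j` for the items rounded down. -/
noncomputable def roundedErr (w : List (ℕ × ℕ × ℕ)) (j : ℕ) : ℝ :=
  sqErr (lowLabels w j) + sqErr (highLabels w j)

/-- Total squared error of the split `j`. -/
noncomputable def splitErr (l : List (ℕ × ℕ)) (j : ℕ) : ℝ :=
  sqErr (leftLabels l j) + sqErr (rightLabels l j)

theorem splitErr_perm {l l' : List (ℕ × ℕ)} (h : l.Perm l') (j : ℕ) :
    splitErr l j = splitErr l' j := by
  rw [splitErr, splitErr, leftLabels, rightLabels, sqErr_perm ((h.filter _).map _),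
    sqErr_perm ((h.filter _).map _)]
  rfl

/-- Rounding moves the labels `D` of the straddling items from the right part to the left one. Both
errors arise from the configuration without `D` by adding `D` to one part, so both lie in the same
interval of length `|D| M²`; this avoids a factor `2`. -/
theorem abs_splitErr_sub_le {M : ℕ} {w : List (ℕ × ℕ × ℕ)} (hM : ∀ i ∈ w, i.2.2 ≤ M) (j : ℕ) :
    |splitErr (w.map Prod.snd) j - roundedErr w j| ≤ straddling w j * (M : ℝ) ^ 2 := by
  set D := (w.filter fun i => leftEnd i ≤ j ∧ j < i.2.1).map fun i => i.2.2 with hD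
  have hlen : D.length = straddling w j := by
    simp [hD, straddling, List.countP_eq_length_filter]
  have hle : ∀ i : ℕ × ℕ × ℕ, leftEnd i ≤ i.2.1 := fun i => Nat.sub_le _ _
  have hleft : leftLabels (w.map Prod.snd) j = (w.filter fun i => i.2.1 ≤ j).map fun i => i.2.2 := by
    simp [leftLabels, List.filter_map, Function.comp_def]
  have hright : rightLabels (w.map Prod.snd) j =
      (w.filter fun i => j < i.2.1).map fun i => i.2.2 := by
    simp [rightLabels, List.filter_map, Function.comp_def]
  have hlow : (lowLabels w j).Perm (D ++ leftLabels (w.map Prod.snd) j) := by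
    rw [hleft, hD, lowLabels, ← List.map_append]
    refine List.Perm.map _ ?_
    refine (List.filter_append_perm (fun i => decide (j < i.2.1)) _).symm.trans ?_
    rw [List.filter_filter, List.filter_filter]
    refine List.Perm.of_eq ?_
    congr 1 <;> refine List.filter_congr fun i _ => ?_
    · rw [Bool.eq_iff_iff]; simp; tauto
    · have := hle i
      rw [Bool.eq_iff_iff]; simp; omega
  have hhigh : (rightLabels (w.map Prod.snd) j).Perm (D ++ highLabels w j) := by
    rw [hright, hD, highLabels, ← List.map_append]
    refine List.Perm.map _ ?_
    refine (List.filter_append_perm (fun i => decide (leftEnd i ≤ j)) _).symm.trans ?_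
    rw [List.filter_filter, List.filter_filter]
    refine List.Perm.of_eq ?_
    congr 1 <;> refine List.filter_congr fun i _ => ?_
    · rw [Bool.eq_iff_iff]; simp
    · have := hle i
      rw [Bool.eq_iff_iff]; simp; omega
  have hbd : ∀ p : ℕ × ℕ × ℕ → Bool, ∀ y ∈ (w.filter p).map fun i => i.2.2, y ≤ M := by
    intro p y hy
    obtain ⟨i, hi, rfl⟩ := List.mem_map.1 hy
    exact hM i (List.mem_of_mem_filter hi)
  obtain ⟨a1, a2⟩ := sqErr_append_bounds (hbd _ : ∀ y ∈ D, y ≤ M) (ys := leftLabels _ j)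
    (by rw [hleft]; exact hbd _)
  obtain ⟨b1, b2⟩ := sqErr_append_bounds (hbd _ : ∀ y ∈ D, y ≤ M) (ys := highLabels w j)
    (hbd _)
  rw [splitErr, roundedErr, sqErr_perm hlow, sqErr_perm hhigh, ← hlen, abs_le]
  constructor <;> linarith

/-! ### Scores of splits as fractions of natural numbers -/

/-- Numerator of `s ^ 2 / a + s' ^ 2 / a'`, where a part with `a` of `t` items has label sum `s` of
`S`, and the other part has `a'` items and label sum `s'`; zero counts are replaced by `1`. -/
def scoreNum (a s t S : ℕ) : ℕ :=
  s * s * ((t - a) + (1 - (t - a))) + (S - s) * (S - s) * (a + (1 - a))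

/-- The denominator belonging to `scoreNum`. -/
def scoreDen (a t : ℕ) : ℕ := (a + (1 - a)) * ((t - a) + (1 - (t - a)))

theorem scoreDen_pos (a t : ℕ) : 0 < scoreDen a t := Nat.mul_pos (by omega) (by omega)

/-- The sum of squares depends only on the whole list, so minimizing the error means maximizing the
score. Replacing an empty count by `1` is harmless, as its label sum is `0`, and makes cross
multiplication valid. -/
theorem sqErr_add_eq (as bs : List ℕ) :
    sqErr as + sqErr bs = ((as ++ bs).map fun y : ℕ => (y : ℝ) ^ 2).sum -
      (scoreNum as.length as.sum (as ++ bs).length (as ++ bs).sum : ℝ) /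
        scoreDen as.length (as ++ bs).length := by
  have key : ∀ ys : List ℕ, (ys.sum : ℝ) ^ 2 / ys.length =
      (ys.sum : ℝ) ^ 2 / ((ys.length + (1 - ys.length) : ℕ) : ℝ) := by
    intro ys
    rcases Nat.eq_zero_or_pos ys.length with h | h
    · have h0 : ys = [] := List.eq_nil_of_length_eq_zero h
      simp [h0]
    · rw [show ys.length + (1 - ys.length) = ys.length by omega]
  rw [sqErr_eq, sqErr_eq, key as, key bs, scoreNum, scoreDen]
  simp only [List.length_append, List.sum_append, List.map_append, Nat.add_sub_cancel_left]
  have h1 : ((as.length + (1 - as.length) : ℕ) : ℝ) ≠ 0 := by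
    exact_mod_cast (by omega : as.length + (1 - as.length) ≠ 0)
  have h2 : ((bs.length + (1 - bs.length) : ℕ) : ℝ) ≠ 0 := by
    exact_mod_cast (by omega : bs.length + (1 - bs.length) ≠ 0)
  simp only [Nat.cast_mul, Nat.cast_add] at *
  field_simp
  ring

/-- The number of items in nodes that start at `z`. -/
def startCount (w : List (ℕ × ℕ × ℕ)) (z : ℕ) : ℕ := w.countP fun i => leftEnd i = z

/-- The label sum of the items in nodes that start at `z`. -/
def startSum (w : List (ℕ × ℕ × ℕ)) (z : ℕ) : ℕ :=
  ((w.filter fun i => leftEnd i = z).map fun i => i.2.2).sum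

theorem startCount_cons (i : ℕ × ℕ × ℕ) (w : List (ℕ × ℕ × ℕ)) (z : ℕ) :
    startCount (i :: w) z = startCount w z + if leftEnd i = z then 1 else 0 := by
  simp [startCount, List.countP_cons]

theorem startSum_cons (i : ℕ × ℕ × ℕ) (w : List (ℕ × ℕ × ℕ)) (z : ℕ) :
    startSum (i :: w) z = startSum w z + if leftEnd i = z then i.2.2 else 0 := by
  simp only [startSum, List.filter_cons, decide_eq_true_eq]
  split_ifs <;> simp [add_comm]

theorem length_lowLabels (w : List (ℕ × ℕ × ℕ)) (j : ℕ) :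
    (lowLabels w j).length = ∑ z ∈ Finset.range (j + 1), startCount w z := by
  induction w with
  | nil => simp [lowLabels, startCount]
  | cons i w ih =>
    simp only [lowLabels, List.length_map] at ih
    simp only [startCount_cons, Finset.sum_add_distrib, ← ih, Finset.sum_ite_eq, Finset.mem_range,
      lowLabels, List.filter_cons, decide_eq_true_eq, Nat.lt_succ_iff]
    split_ifs <;> simp

theorem sum_lowLabels (w : List (ℕ × ℕ × ℕ)) (j : ℕ) :
    (lowLabels w j).sum = ∑ z ∈ Finset.range (j + 1), startSum w z := by
  induction w with
  | nil => simp [lowLabels, startSum]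
  | cons i w ih =>
    simp only [lowLabels] at ih
    simp only [startSum_cons, Finset.sum_add_distrib, ← ih, Finset.sum_ite_eq, Finset.mem_range,
      lowLabels, List.filter_cons, decide_eq_true_eq, Nat.lt_succ_iff]
    split_ifs <;> simp [add_comm]

/-- The label sum of the placed items. -/
def labelSum (w : List (ℕ × ℕ × ℕ)) : ℕ := (w.map fun i => i.2.2).sum

/-- The number of items in nodes that start before `j`. -/
def prefixCount (w : List (ℕ × ℕ × ℕ)) (j : ℕ) : ℕ := ∑ z ∈ Finset.range j, startCount w z

/-- The label sum of the items in nodes that start before `j`. -/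
def prefixSum (w : List (ℕ × ℕ × ℕ)) (j : ℕ) : ℕ := ∑ z ∈ Finset.range j, startSum w z

/-- The numerator of the score of the split `j` computed from the stored data. -/
def splitNum (w : List (ℕ × ℕ × ℕ)) (j : ℕ) : ℕ :=
  scoreNum (prefixCount w (j + 1)) (prefixSum w (j + 1)) w.length (labelSum w)

/-- The denominator belonging to `splitNum`. -/
def splitDen (w : List (ℕ × ℕ × ℕ)) (j : ℕ) : ℕ := scoreDen (prefixCount w (j + 1)) w.length

theorem low_append_high_perm (w : List (ℕ × ℕ × ℕ)) (j : ℕ) :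
    (lowLabels w j ++ highLabels w j).Perm (w.map fun i => i.2.2) := by
  rw [lowLabels, highLabels, ← List.map_append]
  refine List.Perm.map _ ?_
  simpa only [decide_not] using List.filter_append_perm (fun i => decide (leftEnd i ≤ j)) w

theorem roundedErr_eq (w : List (ℕ × ℕ × ℕ)) (j : ℕ) :
    roundedErr w j = ((w.map fun i => i.2.2).map fun y : ℕ => (y : ℝ) ^ 2).sum -
      (splitNum w j : ℝ) / splitDen w j := by
  have hp := low_append_high_perm w j
  rw [roundedErr, sqErr_add_eq, (hp.map _).sum_eq, hp.sum_eq, hp.length_eq, length_lowLabels,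
    sum_lowLabels, List.length_map]
  rfl

/-- A split with the best score has almost optimal loss. -/
theorem splitLoss_le {N M k K H : ℕ} {ε : ℝ} {w : List (ℕ × ℕ × ℕ)} {l : List (ℕ × ℕ)} {j : ℕ}
    (hε : 0 < ε) (hk : 1 / ε ≤ k) (hK : 2 * (H + 1) * M * M * k ≤ K) (hN : N < 2 ^ H)
    (hw : Placed (2 ^ H) K H w) (hl : l.Perm (w.map Prod.snd)) (hM : ∀ i ∈ w, i.2.2 ≤ M)
    (hne : l ≠ []) (hj : j ≤ N)
    (hbest : ∀ j' ≤ N, splitNum w j' * splitDen w j ≤ splitNum w j * splitDen w j') :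
    splitLoss l j ≤ optLoss N l + ε := by
  have hlen : l.length = w.length := by simpa using hl.length_eq
  have hmpos : (0 : ℝ) < l.length := by
    exact_mod_cast List.length_pos_iff.2 hne
  have hsp : ∀ i, splitLoss l i = (1 / (l.length : ℝ)) * splitErr (w.map Prod.snd) i := by
    intro i
    rw [← splitErr_perm hl]
    rfl
  -- Each rounding error is at most half the allowance, because two of them are incurred below. The
  -- factor `H + 1` in `K`, rather than `H`, can always be cancelled.
  have herr : ∀ i ≤ N, 2 * (straddling w i * (M : ℝ) ^ 2) ≤ l.length * ε := by
    intro i hi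
    have h1 : straddling w i * (2 * (H + 1) * M * M * k) ≤ H * l.length := by
      rw [hlen]
      exact (Nat.mul_le_mul_left _ hK).trans (straddling_mul_le hw (by omega))
    have h2 : (H + 1) * (2 * straddling w i * M * M * k) ≤ (H + 1) * l.length := by
      calc (H + 1) * (2 * straddling w i * M * M * k)
          = straddling w i * (2 * (H + 1) * M * M * k) := by ring
        _ ≤ _ := h1.trans (Nat.mul_le_mul_right _ (by omega))
    have h3 := Nat.le_of_mul_le_mul_left h2 (by omega)
    have h4 : 2 * (straddling w i * (M : ℝ) ^ 2) * k ≤ l.length := by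
      have : ((2 * straddling w i * M * M * k : ℕ) : ℝ) ≤ l.length := by exact_mod_cast h3
      push_cast at this
      linarith
    have h5 : 1 ≤ k * ε := by rwa [div_le_iff₀ hε] at hk
    have h6 : 0 ≤ 2 * (straddling w i * (M : ℝ) ^ 2) := by positivity
    nlinarith
  have hround : ∀ i ≤ N, roundedErr w j ≤ roundedErr w i := by
    intro i hi
    rw [roundedErr_eq, roundedErr_eq]
    have h1 : (0 : ℝ) < splitDen w i := by exact_mod_cast scoreDen_pos _ _
    have h2 : (0 : ℝ) < splitDen w j := by exact_mod_cast scoreDen_pos _ _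
    have : (splitNum w i : ℝ) / splitDen w i ≤ splitNum w j / splitDen w j := by
      rw [div_le_div_iff₀ h1 h2]
      exact_mod_cast hbest i hi
    linarith
  rw [← sub_le_iff_le_add]
  refine Finset.le_inf' _ _ ?_
  intro i hi
  have hi : i ≤ N := by simpa [Nat.lt_succ_iff] using hi
  rw [hsp, hsp, sub_le_iff_le_add, one_div, inv_mul_le_iff₀ hmpos, mul_add,
    mul_inv_cancel_left₀ hmpos.ne']
  have h1 := abs_le.1 (abs_splitErr_sub_le hM i)
  have h2 := abs_le.1 (abs_splitErr_sub_le hM j)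
  have h3 := herr i hi
  have h4 := herr j hj
  have h5 := hround i hi
  linarith [h1.1, h2.2]

/-! ### The programs -/

/-- The content of the cell with the fixed address `i`. -/
abbrev reg (i : ℕ) : Expr := .get (.const i)

/-- Write into the cell with the fixed address `i`. -/
abbrev setReg (i : ℕ) (e : Expr) : Prog := .set (.const i) e

/-- The address of the entry `e` of the array `r`, for `r = 0, 1, 2`. -/
abbrev entry (r : ℕ) (e : Expr) : Expr := .add (.const (16 + r)) (.mul (.const 3) e)

/-- The tree node above the leaf of the item in the cells `0`, `1` whose width is in the
cell `5`. -/
abbrev nodeExpr : Expr := .div (.add (reg 3) (reg 0)) (reg 5)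

/-- The left end of the interval of `nodeExpr`. -/
abbrev startExpr : Expr := .sub (reg 0) (.mod (reg 0) (reg 5))

/-- `e`, or `1` if `e` is zero. -/
abbrev atLeastOne (e : Expr) : Expr := .add e (.sub (.const 1) e)

/-- `scoreNum` of the contents of the cells `8`, `9`, `2`, `6`. -/
abbrev numExpr : Expr :=
  .add (.mul (.mul (reg 9) (reg 9)) (atLeastOne (.sub (reg 2) (reg 8))))
    (.mul (.mul (.sub (reg 6) (reg 9)) (.sub (reg 6) (reg 9))) (atLeastOne (reg 8)))

/-- `scoreDen` of the contents of the cells `8`, `2`. -/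
abbrev denExpr : Expr := .mul (atLeastOne (reg 8)) (atLeastOne (.sub (reg 2) (reg 8)))

/-- Before the stream: the number of leaves is put into the cell `3`, the inverse of the capacity
of the nodes into the cell `4`, and `N` into the cell `7`. -/
def initProg : Prog :=
  .seq (setReg 7 (reg 0)) <|
  .seq (setReg 3 (.const 1)) <|
  .seq (setReg 4 (.const 1)) <|
  .seq (.loop (.sub (.add (reg 7) (.const 1)) (reg 3))
    (.seq (setReg 3 (.mul (.const 2) (reg 3))) (setReg 4 (.add (reg 4) (.const 1))))) <|
  .seq (setReg 4 (.add (.mul (.mul (.mul (.mul (.const 2) (reg 4)) (reg 1)) (reg 1)) (reg 2))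
    (.const 1))) <|
  setReg 2 (.const 0)

/-- On arrival of an item: descend from the root to the first node that has room. -/
def updateProg : Prog :=
  .seq (setReg 2 (.add (reg 2) (.const 1))) <|
  .seq (setReg 6 (.add (reg 6) (reg 1))) <|
  .seq (setReg 5 (reg 3)) <|
  -- The product is nonzero exactly when the node is not a leaf (width above `1`) and one more item
  -- would exceed its share of the length, which already includes the new item.
  .seq (.loop (.mul (.sub (reg 5) (.const 1))
      (.sub (.mul (.add (.get (entry 0 nodeExpr)) (.const 1)) (reg 4)) (reg 2)))
    (setReg 5 (.div (reg 5) (.const 2)))) <|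
  .seq (.set (entry 0 nodeExpr) (.add (.get (entry 0 nodeExpr)) (.const 1))) <|
  .seq (.set (entry 1 startExpr) (.add (.get (entry 1 startExpr)) (.const 1))) <|
  .set (entry 2 startExpr) (.add (.get (entry 2 startExpr)) (reg 1))

/-- One round of the query: the split in the cell `5` is compared with the best one so far. -/
def scanStep : Prog :=
  .seq (setReg 8 (.add (reg 8) (.get (entry 1 (reg 5))))) <|
  .seq (setReg 9 (.add (reg 9) (.get (entry 2 (reg 5))))) <|
  .seq (.ite (.sub (.mul numExpr (reg 11)) (.mul (reg 10) denExpr))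
    (.seq (setReg 10 numExpr) (.seq (setReg 11 denExpr) (setReg 0 (reg 5)))) .skip) <|
  setReg 5 (.add (reg 5) (.const 1))

/-- After the stream: find the split with the best score. -/
def queryProg : Prog :=
  .seq (setReg 0 (.const 0)) <|
  .seq (setReg 5 (.const 0)) <|
  .seq (setReg 11 (.const 1)) <|
  .loop (.sub (.add (reg 7) (.const 1)) (reg 5)) scanStep

/-- The splitting algorithm. It draws no random numbers, so its guarantees hold with certainty. -/
def splitAlgorithm : Algorithm := ⟨initProg, updateProg, queryProg⟩

/-! ### Memory layout -/

/-- The left ends of the nodes in use. -/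
def usedStarts (w : List (ℕ × ℕ × ℕ)) : Finset ℕ := (w.map leftEnd).toFinset

/-- The addresses of the cells that may be nonzero after the items `w` have been placed. -/
def cells (P : ℕ) (w : List (ℕ × ℕ × ℕ)) : Finset ℕ :=
  Finset.range 16 ∪ ((usedNodes P w).image (16 + 3 * ·) ∪
    ((usedStarts w).image (17 + 3 * ·) ∪ (usedStarts w).image (18 + 3 * ·)))

/-- The bit length of a node number reveals its height, so the node determines its left end. Hence
there are no more left ends than nodes in use. -/
theorem Placed.leftEnd_eq {K H : ℕ} {w : List (ℕ × ℕ × ℕ)} (hw : Placed (2 ^ H) K H w) :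
    ∀ i ∈ w, leftEnd i = node (2 ^ H) i * 2 ^ (H + 1 - (node (2 ^ H) i).size) - 2 ^ H := by
  induction hw with
  | nil => simp
  | @cons w h x y _ hh hx _ _ ih =>
    intro i hi
    rcases List.mem_cons.1 hi with rfl | hi
    · have hpos : 0 < 2 ^ h := by positivity
      have hP : 2 ^ H = 2 ^ (H - h) * 2 ^ h := by rw [← pow_add]; congr 1; omega
      have h1 : H - h < (node (2 ^ H) (h, x, y)).size := by
        rw [Nat.lt_size, node, Nat.le_div_iff_mul_le hpos, ← hP]
        exact Nat.le_add_right _ _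
      have h2 : (node (2 ^ H) (h, x, y)).size ≤ H - h + 1 := by
        rw [Nat.size_le, node, Nat.div_lt_iff_lt_mul hpos, pow_succ]
        simp only
        nlinarith
      have hmod : (2 ^ H + x) % 2 ^ h = x % 2 ^ h := by
        rw [hP, Nat.mul_add_mod_self_right]
      rw [show H + 1 - (node (2 ^ H) (h, x, y)).size = h by omega]
      simp only [leftEnd, node]
      have := Nat.div_add_mod (2 ^ H + x) (2 ^ h)
      rw [mul_comm] at this
      omega
    · exact ih i hi

theorem Placed.card_cells_le {K H : ℕ} {w : List (ℕ × ℕ × ℕ)} (hw : Placed (2 ^ H) K H w)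
    (hK : 1 ≤ K) : (cells (2 ^ H) w).card ≤ 16 + 39 * K * w.length.size := by
  have h1 := hw.card_usedNodes_le hK
  have h2 : (usedStarts w).card ≤ (usedNodes (2 ^ H) w).card := by
    have : usedStarts w ⊆ (usedNodes (2 ^ H) w).image
        fun v => v * 2 ^ (H + 1 - v.size) - 2 ^ H := by
      intro z hz
      obtain ⟨i, hi, rfl⟩ := List.mem_map.1 (List.mem_toFinset.1 hz)
      exact Finset.mem_image.2
        ⟨_, List.mem_toFinset.2 (List.mem_map.2 ⟨i, hi, rfl⟩), (hw.leftEnd_eq i hi).symm⟩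
    exact (Finset.card_le_card this).trans Finset.card_image_le
  have h3 : (cells (2 ^ H) w).card ≤ 16 + ((usedNodes (2 ^ H) w).card +
      ((usedStarts w).card + (usedStarts w).card)) := by
    refine (Finset.card_union_le _ _).trans (Nat.add_le_add (by simp) ?_)
    refine (Finset.card_union_le _ _).trans (Nat.add_le_add Finset.card_image_le ?_)
    exact (Finset.card_union_le _ _).trans
      (Nat.add_le_add Finset.card_image_le Finset.card_image_le)
  have h4 : 39 * K * w.length.size = 3 * (13 * K * w.length.size) := by ring
  omega

theorem Placed.lt_of_mem {P K H : ℕ} {w : List (ℕ × ℕ × ℕ)} (hw : Placed P K H w) :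
    ∀ i ∈ w, i.2.1 < P := by
  induction hw with
  | nil => simp
  | cons _ _ hx _ _ ih => simpa [hx] using ih

theorem Placed.cells_le {P K H : ℕ} {w : List (ℕ × ℕ × ℕ)} (hw : Placed P K H w) :
    ∀ a ∈ cells P w, a ≤ 18 + 6 * P := by
  intro a ha
  have key : ∀ i ∈ w, node P i ≤ 2 * P ∧ leftEnd i ≤ P := fun i hi => by
    have h1 := hw.lt_of_mem i hi
    have h2 : node P i ≤ P + i.2.1 := Nat.div_le_self _ _
    have h3 : leftEnd i ≤ i.2.1 := Nat.sub_le _ _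
    omega
  simp only [cells, usedNodes, usedStarts, Finset.mem_union, Finset.mem_range, Finset.mem_image,
    List.mem_toFinset, List.mem_map] at ha
  rcases ha with h | ⟨_, ⟨i, hi, rfl⟩, rfl⟩ | ⟨_, ⟨i, hi, rfl⟩, rfl⟩ | ⟨_, ⟨i, hi, rfl⟩, rfl⟩
  · omega
  all_goals have := key i hi; omega

theorem cells_subset_cons (P : ℕ) (i : ℕ × ℕ × ℕ) (w : List (ℕ × ℕ × ℕ)) :
    cells P w ⊆ cells P (i :: w) := by
  have h1 : usedNodes P w ⊆ usedNodes P (i :: w) := by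
    simp [usedNodes, List.toFinset_cons, Finset.subset_insert]
  have h2 : usedStarts w ⊆ usedStarts (i :: w) := by
    simp [usedStarts, List.toFinset_cons, Finset.subset_insert]
  exact Finset.union_subset_union_right (Finset.union_subset_union (Finset.image_subset_image h1)
    (Finset.union_subset_union (Finset.image_subset_image h2) (Finset.image_subset_image h2)))

theorem mem_cells_of_lt {a P : ℕ} {w : List (ℕ × ℕ × ℕ)} (ha : a < 16) : a ∈ cells P w :=
  Finset.mem_union_left _ (Finset.mem_range.2 ha)

theorem node_mem_cells {P : ℕ} {i : ℕ × ℕ × ℕ} {w : List (ℕ × ℕ × ℕ)} :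
    16 + 3 * node P i ∈ cells P (i :: w) := by
  simp [cells, usedNodes]

theorem count_mem_cells {P : ℕ} {i : ℕ × ℕ × ℕ} {w : List (ℕ × ℕ × ℕ)} :
    17 + 3 * leftEnd i ∈ cells P (i :: w) := by
  simp [cells, usedStarts]

theorem sum_mem_cells {P : ℕ} {i : ℕ × ℕ × ℕ} {w : List (ℕ × ℕ × ℕ)} :
    18 + 3 * leftEnd i ∈ cells P (i :: w) := by
  simp [cells, usedStarts]

/-- The memory `m` between two items of the stream when the items `w` have been placed. -/
structure Holds (N P K : ℕ) (w : List (ℕ × ℕ × ℕ)) (m : Mem) : Prop where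
  length : m 2 = w.length
  leaves : m 3 = P
  capacity : m 4 = K
  total : m 6 = labelSum w
  bound : m 7 = N
  zero : ∀ a, 8 ≤ a → a < 16 → m a = 0
  node : ∀ v, m (16 + 3 * v) = nodeCount P w v
  count : ∀ z, m (17 + 3 * z) = startCount w z
  sum : ∀ z, m (18 + 3 * z) = startSum w z

theorem update_apply (m : Mem) (a v b : ℕ) : (m.update a v) b = if b = a then v else m b := by
  rw [Finsupp.coe_update, Function.update_apply]

theorem Holds.arrive {N P K x y : ℕ} {w : List (ℕ × ℕ × ℕ)} {m : Mem} (h : Holds N P K w m) :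
    Holds N P K w ((m.update 0 x).update 1 y) where
  length := by simp [update_apply, h.length]
  leaves := by simp [update_apply, h.leaves]
  capacity := by simp [update_apply, h.capacity]
  total := by simp [update_apply, h.total]
  bound := by simp [update_apply, h.bound]
  zero a h1 h2 := by
    rw [update_apply, update_apply, if_neg (by omega), if_neg (by omega), h.zero a h1 h2]
  node v := by rw [update_apply, update_apply, if_neg (by omega), if_neg (by omega), h.node]
  count v := by rw [update_apply, update_apply, if_neg (by omega), if_neg (by omega), h.count]
  sum v := by rw [update_apply, update_apply, if_neg (by omega), if_neg (by omega), h.sum]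

/-! ### Correctness of the three programs -/

theorem labelSum_cons (i : ℕ × ℕ × ℕ) (w : List (ℕ × ℕ × ℕ)) :
    labelSum (i :: w) = labelSum w + i.2.2 := by
  simp [labelSum, add_comm]

theorem labelSum_le {M : ℕ} {w : List (ℕ × ℕ × ℕ)} (h : ∀ i ∈ w, i.2.2 ≤ M) :
    labelSum w ≤ w.length * M := by
  have := List.sum_le_card_nsmul (w.map fun i => i.2.2) M (by simpa using fun c a b => h (a, b, c))
  simpa [labelSum] using this

theorem startSum_le (w : List (ℕ × ℕ × ℕ)) (z : ℕ) : startSum w z ≤ labelSum w := by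
  induction w with
  | nil => simp [startSum, labelSum]
  | cons i w ih =>
    rw [startSum_cons, labelSum_cons]
    split_ifs <;> omega

theorem exists_greatest (p : ℕ → Prop) (H : ℕ) :
    ∃ h ≤ H, (h = 0 ∨ p h) ∧ ∀ h', h < h' → h' ≤ H → ¬ p h' := by
  induction H with
  | zero => exact ⟨0, le_rfl, Or.inl rfl, fun h' h1 h2 => by omega⟩
  | succ H ih =>
    by_cases hp : p (H + 1)
    · exact ⟨H + 1, le_rfl, Or.inr hp, fun h' h1 h2 => by omega⟩
    · obtain ⟨h, h1, h2, h3⟩ := ih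
      refine ⟨h, by omega, h2, fun h' h4 h5 => ?_⟩
      rcases h5.eq_or_lt with rfl | h5
      exacts [hp, h3 h' h4 (by omega)]

theorem Placed.exists_cons {P K H x : ℕ} {w : List (ℕ × ℕ × ℕ)} (hw : Placed P K H w) (hx : x < P)
    (y : ℕ) : ∃ h, Placed P K H ((h, x, y) :: w) := by
  obtain ⟨h, h1, h2, h3⟩ := exists_greatest
    (fun h => (nodeCount P w ((P + x) / 2 ^ h) + 1) * K ≤ w.length + 1) H
  exact ⟨h, hw.cons h1 hx h2 fun h' h4 h5 => not_le.1 (h3 h' h4 h5)⟩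

/-- The height `h` is fixed beforehand by `Placed.exists_cons`; what remains is that the descent
stops exactly there, after at most `H` halvings of the width. -/
theorem wp_update {V n N M K H h x y : ℕ} {w : List (ℕ × ℕ × ℕ)} {m : Mem}
    (hm : Holds N (2 ^ H) K w m) (h0 : m 0 = x) (h1 : m 1 = y)
    (hw : Placed (2 ^ H) K H ((h, x, y) :: w)) (hM : ∀ i ∈ (h, x, y) :: w, i.2.2 ≤ M)
    (hPV : 2 ^ H ≤ V) (hlV : w.length + 1 ≤ V) (hSV : (w.length + 1) * M ≤ V) :
    Wp V n 2000 (cells (2 ^ H) ((h, x, y) :: w)) updateProg m (2 * H + 10)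
      (Holds N (2 ^ H) K ((h, x, y) :: w)) := by
  have hsum : labelSum ((h, x, y) :: w) ≤ V := (labelSum_le hM).trans hSV
  have hsum' := hsum
  rw [labelSum_cons] at hsum'
  cases hw with
  | cons hw hh hx hfit hfull =>
  have hnode : (2 ^ H + x) / 2 ^ h = node (2 ^ H) (h, x, y) := rfl
  have hleft : x - x % 2 ^ h = leftEnd (h, x, y) := rfl
  have hcount : ∀ p : ℕ × ℕ × ℕ → Bool, w.countP p + 1 ≤ V := fun p =>
    (Nat.add_le_add_right List.countP_le_length 1).trans hlV
  suffices Wp V n 2000 (cells (2 ^ H) ((h, x, y) :: w)) updateProg m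
      (1 + (1 + (1 + (((1 + 1) * (H - h) + 1) + (1 + (1 + 1))))))
      (Holds N (2 ^ H) K ((h, x, y) :: w)) from this.mono (by omega) fun _ _ h => h
  refine Wp.seq (Wp.assign (r := 2) (v := w.length + 1) (by decide) rfl ?_
    (mem_cells_of_lt (by omega)) hlV fun m₁ e₁ f₁ => ?_)
  · simp [Expr.val, hm.length]
  refine Wp.seq (Wp.assign (r := 6) (v := labelSum w + y) (by decide) rfl ?_
    (mem_cells_of_lt (by omega)) hsum' fun m₂ e₂ f₂ => ?_)
  · simp (disch := omega) only [Expr.val, f₁, hm.total, h1]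
  refine Wp.seq (Wp.assign (r := 5) (v := 2 ^ H) (by decide) rfl ?_
    (mem_cells_of_lt (by omega)) hPV fun m₃ e₃ f₃ => ?_)
  · simp (disch := omega) only [Expr.val, f₁, f₂, hm.leaves]
  -- Here `i` is the number of levels still above height `h`. `hfit` makes the test vanish at `i =
  -- 0`, and `hfull` keeps it nonzero for `i > 0`.
  refine Wp.seq ((Wp.loop (k := 1)
    (I := fun i m' => h + i ≤ H ∧ m' 5 = 2 ^ (h + i) ∧ ∀ b, b ≠ 5 → m' b = m₃ b)
    (by decide) ?_ (i := H - h) ?_).mono le_rfl fun m₄ _ hm₄ => ?_)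
  · rintro i m' ⟨hi, e, f⟩ htest
    have hi0 : i ≠ 0 := by
      rintro rfl
      apply htest
      rcases hfit with rfl | hfit
      · simp [Expr.val, e]
      · simp (disch := omega) only [Expr.val, e, f, f₃, f₂, f₁, e₁, h0, hm.leaves, hm.capacity,
          add_zero, hm.node, Nat.sub_eq_zero_of_le hfit, mul_zero]
    obtain ⟨i', rfl⟩ := Nat.exists_eq_succ_of_ne_zero hi0
    refine ⟨i', rfl, Wp.assign (r := 5) (v := 2 ^ (h + i')) (by decide) rfl ?_
      (mem_cells_of_lt (by omega)) ?_ fun m'' e' f' => ⟨by omega, e', fun b hb => ?_⟩⟩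
    · simp only [Expr.val, e]
      rw [Nat.succ_eq_add_one, ← add_assoc, pow_succ, Nat.mul_div_cancel _ (by omega)]
    · exact (Nat.pow_le_pow_right (by omega) (by omega)).trans hPV
    · rw [f' b hb, f b hb]
  · exact ⟨by omega, by rw [e₃]; congr 1; omega, fun _ _ => rfl⟩
  obtain ⟨⟨i, hi, e₄, f₄⟩, htest⟩ := hm₄
  obtain rfl : i = 0 := by
    by_contra hi0
    have hf := hfull (h + i) (by omega) hi
    have hp : 2 ^ 1 ≤ 2 ^ (h + i) := Nat.pow_le_pow_right (by omega) (by omega)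
    simp (disch := omega) only [Expr.val, e₄, f₄, f₃, f₂, f₁, e₁, h0, hm.leaves, hm.capacity,
      add_zero, hm.node, mul_eq_zero] at htest
    omega
  rw [add_zero] at e₄
  refine Wp.seq (Wp.assign (r := 16 + 3 * node (2 ^ H) (h, x, y))
    (v := nodeCount (2 ^ H) w (node (2 ^ H) (h, x, y)) + 1) (by decide) ?_ ?_
    node_mem_cells (hcount _) fun m₅ e₅ f₅ => ?_)
  · simp (disch := omega) only [Expr.val, e₄, f₄, f₃, f₂, f₁, h0, hm.leaves, hnode, add_zero]
  · simp (disch := omega) only [Expr.val, e₄, f₄, f₃, f₂, f₁, h0, hm.leaves, hnode, add_zero,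
      hm.node]
  refine Wp.seq (Wp.assign (r := 17 + 3 * leftEnd (h, x, y))
    (v := startCount w (leftEnd (h, x, y)) + 1) (by decide) ?_ ?_
    count_mem_cells (hcount _) fun m₆ e₆ f₆ => ?_)
  · simp (disch := omega) only [Expr.val, e₄, f₅, f₄, f₃, f₂, f₁, h0, hleft]
  · simp (disch := omega) only [Expr.val, e₄, f₅, f₄, f₃, f₂, f₁, h0, hleft, Nat.reduceAdd,
      hm.count]
  refine Wp.assign (r := 18 + 3 * leftEnd (h, x, y))
    (v := startSum w (leftEnd (h, x, y)) + y) (by decide) ?_ ?_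
    sum_mem_cells ?_ fun m₇ e₇ f₇ => ?_
  · simp (disch := omega) only [Expr.val, e₄, f₆, f₅, f₄, f₃, f₂, f₁, h0, hleft]
  · simp (disch := omega) only [Expr.val, e₄, f₆, f₅, f₄, f₃, f₂, f₁, h0, h1, hleft,
      Nat.reduceAdd, hm.sum]
  · exact (Nat.add_le_add_right (startSum_le _ _) y).trans hsum'
  exact
    { length := by
        simp (disch := omega) only [f₇, f₆, f₅, f₄, f₃, f₂, e₁, List.length_cons]
      leaves := by simp (disch := omega) only [f₇, f₆, f₅, f₄, f₃, f₂, f₁, hm.leaves]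
      capacity := by simp (disch := omega) only [f₇, f₆, f₅, f₄, f₃, f₂, f₁, hm.capacity]
      total := by simp (disch := omega) only [f₇, f₆, f₅, f₄, f₃, e₂, labelSum_cons]
      bound := by simp (disch := omega) only [f₇, f₆, f₅, f₄, f₃, f₂, f₁, hm.bound]
      zero := fun a ha ha' => by
        simp (disch := omega) only [f₇, f₆, f₅, f₄, f₃, f₂, f₁, hm.zero]
      node := fun v => by
        rw [nodeCount_cons]
        simp (disch := omega) only [f₇, f₆]
        split_ifs with hv
        · rw [← hv, e₅]
        · simp (disch := omega) only [f₅, f₄, f₃, f₂, f₁, hm.node, add_zero]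
      count := fun z => by
        rw [startCount_cons]
        simp (disch := omega) only [f₇]
        split_ifs with hz
        · rw [← hz, e₆]
        · simp (disch := omega) only [f₆, f₅, f₄, f₃, f₂, f₁, hm.count, add_zero]
      sum := fun z => by
        rw [startSum_cons]
        split_ifs with hz
        · rw [← hz, e₇]
        · simp (disch := omega) only [f₇, f₆, f₅, f₄, f₃, f₂, f₁, hm.sum, add_zero] }

/-- Only updates have a time bound, so the number of instructions `r` is left unspecified here, as
in `wp_query`. -/
theorem wp_init {V n N M k : ℕ} {m : Mem} (h0 : m 0 = N) (h1 : m 1 = M) (h2 : m 2 = k)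
    (hz : ∀ a, 3 ≤ a → m a = 0) (hNV : N ≤ V) (hPV : 2 ^ N.size ≤ V) (hHV : N.size + 1 ≤ V)
    (hKV : 2 * (N.size + 1) * M * M * k + 1 ≤ V) :
    ∃ r, Wp V n 2000 (cells (2 ^ N.size) []) initProg m r
      (Holds N (2 ^ N.size) (2 * (N.size + 1) * M * M * k + 1) []) := by
  have h1V : 1 ≤ V := by omega
  refine ⟨1 + (1 + (1 + (((1 + 1 + 1) * N.size + 1) + (1 + 1)))), ?_⟩
  refine Wp.seq (Wp.assign (r := 7) (v := N) (by decide) rfl ?_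
    (mem_cells_of_lt (by omega)) hNV fun m₁ e₁ f₁ => ?_)
  · simp only [Expr.val, h0]
  refine Wp.seq (Wp.assign (r := 3) (v := 1) (by decide) rfl rfl
    (mem_cells_of_lt (by omega)) h1V fun m₂ e₂ f₂ => ?_)
  refine Wp.seq (Wp.assign (r := 4) (v := 1) (by decide) rfl rfl
    (mem_cells_of_lt (by omega)) h1V fun m₃ e₃ f₃ => ?_)
  refine Wp.seq ((Wp.loop (k := 1 + 1) (I := fun i m' => ∃ j, j + i = N.size ∧ m' 3 = 2 ^ j ∧
    m' 4 = j + 1 ∧ ∀ b, b ≠ 3 → b ≠ 4 → m' b = m₃ b) (by decide) ?_ (i := N.size)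
    ?_).mono le_rfl fun m₄ _ hm₄ => ?_)
  · rintro i m' ⟨j, hj, e, e', f⟩ htest
    simp (disch := omega) only [Expr.val, e, f, f₃, f₂, e₁] at htest
    have hlt : j < N.size := Nat.lt_size.2 (by omega)
    refine ⟨i - 1, by omega, Wp.seq (Wp.assign (r := 3) (v := 2 ^ (j + 1)) (by decide) rfl ?_
      (mem_cells_of_lt (by omega)) ?_ fun m₅ e₅ f₅ => Wp.assign (r := 4) (v := j + 1 + 1)
      (by decide) rfl ?_ (mem_cells_of_lt (by omega)) (by omega)
      fun m₆ e₆ f₆ => ⟨j + 1, by omega, ?_, e₆, fun b hb hb' => ?_⟩)⟩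
    · simp only [Expr.val, e]
      rw [pow_succ, mul_comm]
    · exact (Nat.pow_le_pow_right (by omega) hlt).trans hPV
    · simp (disch := omega) only [Expr.val, f₅, e']
    · simp (disch := omega) only [f₆, e₅]
    · rw [f₆ b hb', f₅ b hb, f b hb hb']
  · exact ⟨0, by omega, by simp (disch := omega) only [f₃, e₂, pow_zero], e₃, fun _ _ _ => rfl⟩
  obtain ⟨⟨i, j, hj, e₄, e₄', f₄⟩, htest⟩ := hm₄
  simp (disch := omega) only [Expr.val, e₄, f₄, f₃, f₂, e₁] at htest
  obtain rfl : j = N.size := by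
    by_contra hne
    have := Nat.lt_size.1 (show j < N.size by omega)
    omega
  refine Wp.seq (Wp.assign (r := 4) (by decide) rfl ?_ (mem_cells_of_lt (by omega)) hKV
    fun m₅ e₅ f₅ => ?_)
  · simp (disch := omega) only [Expr.val, e₄', f₄, f₃, f₂, f₁, h1, h2]
  refine Wp.assign (r := 2) (v := 0) (by decide) rfl rfl (mem_cells_of_lt (by omega))
    (Nat.zero_le _) fun m₆ e₆ f₆ => ?_
  exact
    { length := e₆
      leaves := by simp (disch := omega) only [f₆, f₅, e₄]
      capacity := by simp (disch := omega) only [f₆, e₅]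
      total := by
        simp (disch := omega) only [f₆, f₅, f₄, f₃, f₂, f₁, hz]
        rfl
      bound := by simp (disch := omega) only [f₆, f₅, f₄, f₃, f₂, e₁]
      zero := fun a ha ha' => by
        simp (disch := omega) only [f₆, f₅, f₄, f₃, f₂, f₁, hz]
      node := fun v => by
        simp (disch := omega) only [f₆, f₅, f₄, f₃, f₂, f₁, hz]
        rfl
      count := fun v => by
        simp (disch := omega) only [f₆, f₅, f₄, f₃, f₂, f₁, hz]
        rfl
      sum := fun v => by
        simp (disch := omega) only [f₆, f₅, f₄, f₃, f₂, f₁, hz]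
        rfl }

theorem prefixCount_le (w : List (ℕ × ℕ × ℕ)) (j : ℕ) : prefixCount w j ≤ w.length := by
  cases j with
  | zero => simp [prefixCount]
  | succ j =>
    rw [prefixCount, ← length_lowLabels, lowLabels, List.length_map]
    exact List.length_filter_le _ _

theorem prefixSum_le (w : List (ℕ × ℕ × ℕ)) (j : ℕ) : prefixSum w j ≤ labelSum w := by
  cases j with
  | zero => simp [prefixSum]
  | succ j =>
    have := (low_append_high_perm w j).sum_eq
    rw [List.sum_append] at this
    rw [prefixSum, ← sum_lowLabels, labelSum]
    omega

theorem scoreNum_le {a s t S : ℕ} (ha : a ≤ t) (hs : s ≤ S) :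
    scoreNum a s t S ≤ 2 * (S * S * (t + 1)) := by
  have h1 : s * s * ((t - a) + (1 - (t - a))) ≤ S * S * (t + 1) :=
    Nat.mul_le_mul (Nat.mul_le_mul hs hs) (by omega)
  have h2 : (S - s) * (S - s) * (a + (1 - a)) ≤ S * S * (t + 1) :=
    Nat.mul_le_mul (Nat.mul_le_mul (by omega) (by omega)) (by omega)
  rw [scoreNum]
  omega

theorem scoreDen_le {a t : ℕ} (ha : a ≤ t) : scoreDen a t ≤ (t + 1) * (t + 1) :=
  Nat.mul_le_mul (by omega) (by omega)

/-- The memory during the query, before the split `j` is examined. -/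
structure Scanned (N : ℕ) (w : List (ℕ × ℕ × ℕ)) (j : ℕ) (m : Mem) : Prop where
  length : m 2 = w.length
  total : m 6 = labelSum w
  bound : m 7 = N
  current : m 5 = j
  prefixCount : m 8 = prefixCount w j
  prefixSum : m 9 = prefixSum w j
  count : ∀ z, m (17 + 3 * z) = startCount w z
  sum : ∀ z, m (18 + 3 * z) = startSum w z
  out_le : m 0 ≤ N
  den_pos : 0 < m 11
  best : ∀ i < j, splitNum w i * m 11 ≤ m 10 * splitDen w i
  out : m 10 * splitDen w (m 0) ≤ splitNum w (m 0) * m 11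

/-- Only values written into cells must be at most `V`. The cross products in the test may exceed
it; as temporaries they are covered by `Expr.weight`. -/
theorem wp_scanStep {V n N j : ℕ} {R : Finset ℕ} {w : List (ℕ × ℕ × ℕ)} {m : Mem}
    (hm : Scanned N w j m) (hj : j ≤ N) (hR : ∀ a < 16, a ∈ R) (hNV : N + 1 ≤ V)
    (hnV : 2 * (labelSum w * labelSum w * (w.length + 1)) ≤ V)
    (hdV : (w.length + 1) * (w.length + 1) ≤ V) (hlV : w.length ≤ V) (hSV : labelSum w ≤ V) :
    Wp V n 2000 R scanStep m 7 (Scanned N w (j + 1)) := by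
  have hcount := prefixCount_le w (j + 1)
  have hsum := prefixSum_le w (j + 1)
  have hnum : splitNum w j ≤ V := (scoreNum_le hcount hsum).trans hnV
  have hden : splitDen w j ≤ V := (scoreDen_le hcount).trans hdV
  suffices Wp V n 2000 R scanStep m (1 + (1 + ((1 + (1 + 1) + 1) + 1))) (Scanned N w (j + 1)) from
    this
  refine Wp.seq (Wp.assign (r := 8) (v := prefixCount w (j + 1)) (by decide) rfl ?_
    (hR _ (by omega)) (hcount.trans hlV) fun m₁ e₁ f₁ => ?_)
  · simp (disch := omega) only [Expr.val, hm.prefixCount, hm.current, Nat.reduceAdd, hm.count]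
    rw [prefixCount, prefixCount, Finset.sum_range_succ]
  refine Wp.seq (Wp.assign (r := 9) (v := prefixSum w (j + 1)) (by decide) rfl ?_
    (hR _ (by omega)) (hsum.trans hSV) fun m₂ e₂ f₂ => ?_)
  · simp (disch := omega) only [Expr.val, f₁, hm.prefixSum, hm.current, Nat.reduceAdd, hm.sum]
    rw [prefixSum, prefixSum, Finset.sum_range_succ]
  have hnumE : ∀ m' : Mem, (∀ b < 10, b ≠ 0 → m' b = m₂ b) → numExpr.val m' = splitNum w j := by
    intro m' f
    simp (disch := omega) only [Expr.val, f, e₂, f₂, e₁, f₁, hm.length, hm.total]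
    rfl
  have hdenE : ∀ m' : Mem, (∀ b < 10, b ≠ 0 → m' b = m₂ b) → denExpr.val m' = splitDen w j := by
    intro m' f
    simp (disch := omega) only [Expr.val, f, f₂, e₁, f₁, hm.length]
    rfl
  have htest : (Expr.sub (.mul numExpr (reg 11)) (.mul (reg 10) denExpr)).val m₂ =
      splitNum w j * m 11 - m 10 * splitDen w j := by
    have h1 : m₂ 11 = m 11 := by simp (disch := omega) only [f₂, f₁]
    have h2 : m₂ 10 = m 10 := by simp (disch := omega) only [f₂, f₁]
    change numExpr.val m₂ * m₂ 11 - m₂ 10 * denExpr.val m₂ = _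
    rw [hnumE m₂ fun _ _ _ => rfl, hdenE m₂ fun _ _ _ => rfl, h1, h2]
  have finish : ∀ m₃ : Mem, (∀ b, b ≠ 0 → b ≠ 10 → b ≠ 11 → m₃ b = m₂ b) → m₃ 0 ≤ N →
      0 < m₃ 11 → (∀ i < j + 1, splitNum w i * m₃ 11 ≤ m₃ 10 * splitDen w i) →
      m₃ 10 * splitDen w (m₃ 0) ≤ splitNum w (m₃ 0) * m₃ 11 →
      Wp V n 2000 R (setReg 5 (.add (reg 5) (.const 1))) m₃ 1 (Scanned N w (j + 1)) := by
    intro m₃ f₃ hout hpos hbest hbest'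
    refine Wp.assign (r := 5) (v := j + 1) (by decide) rfl ?_ (hR _ (by omega)) (by omega)
      fun m₄ e₄ f₄ => ?_
    · simp (disch := omega) only [Expr.val, f₃, f₂, f₁, hm.current]
    exact
      { length := by simp (disch := omega) only [f₄, f₃, f₂, f₁, hm.length]
        total := by simp (disch := omega) only [f₄, f₃, f₂, f₁, hm.total]
        bound := by simp (disch := omega) only [f₄, f₃, f₂, f₁, hm.bound]
        current := e₄
        prefixCount := by simp (disch := omega) only [f₄, f₃, f₂, e₁]
        prefixSum := by simp (disch := omega) only [f₄, f₃, e₂]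
        count := fun z => by simp (disch := omega) only [f₄, f₃, f₂, f₁, hm.count]
        sum := fun z => by simp (disch := omega) only [f₄, f₃, f₂, f₁, hm.sum]
        out_le := by rwa [f₄ 0 (by omega)]
        den_pos := by rwa [f₄ 11 (by omega)]
        best := by rwa [f₄ 11 (by omega), f₄ 10 (by omega)]
        out := by rwa [f₄ 11 (by omega), f₄ 10 (by omega), f₄ 0 (by omega)] }
  refine Wp.seq (Wp.ite (by decide) ?_ ?_)
  · intro hlt
    rw [htest] at hlt
    have hlt : m 10 * splitDen w j < splitNum w j * m 11 := by omega
    refine Wp.seq (Wp.assign (r := 10) (v := splitNum w j) (by decide) rfl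
      (hnumE _ fun _ _ _ => rfl) (hR _ (by omega)) hnum fun m₃ e₃ f₃ => ?_)
    refine Wp.seq (k₁ := 1) (k₂ := 1) (Wp.assign (r := 11) (v := splitDen w j) (by decide) rfl
      (hdenE _ fun b hb _ => f₃ b (by omega)) (hR _ (by omega)) hden fun m₄ e₄ f₄ => ?_)
    refine Wp.assign (r := 0) (v := j) (by decide) rfl ?_ (hR _ (by omega)) (by omega)
      fun m₅ e₅ f₅ => ?_
    · simp (disch := omega) only [Expr.val, f₄, f₃, f₂, f₁, hm.current]
    have g10 : m₅ 10 = splitNum w j := by simp (disch := omega) only [f₅, f₄, e₃]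
    have g11 : m₅ 11 = splitDen w j := by simp (disch := omega) only [f₅, e₄]
    refine finish m₅ (fun b hb hb' hb'' => ?_) (e₅ ▸ hj) (g11 ▸ scoreDen_pos _ _)
      (fun i hi => ?_) ?_
    · rw [f₅ b hb, f₄ b hb'', f₃ b hb']
    · rw [g10, g11]
      rcases (Nat.lt_succ_iff.1 hi).eq_or_lt with rfl | hi
      · exact le_rfl
      · have h1 := hm.best i hi
        refine Nat.le_of_mul_le_mul_right ?_ hm.den_pos
        calc splitNum w i * splitDen w j * m 11
            = splitNum w i * m 11 * splitDen w j := by ring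
          _ ≤ m 10 * splitDen w i * splitDen w j := Nat.mul_le_mul_right _ h1
          _ = m 10 * splitDen w j * splitDen w i := by ring
          _ ≤ splitNum w j * m 11 * splitDen w i := Nat.mul_le_mul_right _ hlt.le
          _ = splitNum w j * splitDen w i * m 11 := by ring
    · rw [g10, g11, e₅]
  · intro hge
    rw [htest] at hge
    have g0 : m₂ 0 = m 0 := by simp (disch := omega) only [f₂, f₁]
    have g10 : m₂ 10 = m 10 := by simp (disch := omega) only [f₂, f₁]
    have g11 : m₂ 11 = m 11 := by simp (disch := omega) only [f₂, f₁]
    refine Wp.skip (finish m₂ (fun _ _ _ _ => rfl) (g0 ▸ hm.out_le) (g11 ▸ hm.den_pos)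
      (fun i hi => ?_) (by rw [g0, g10, g11]; exact hm.out))
    rw [g10, g11]
    rcases (Nat.lt_succ_iff.1 hi).eq_or_lt with rfl | hi
    · omega
    · exact hm.best i hi

theorem wp_query {V n N P K : ℕ} {w : List (ℕ × ℕ × ℕ)} {m : Mem}
    (hm : Holds N P K w m) (hNV : N + 1 ≤ V)
    (hnV : 2 * (labelSum w * labelSum w * (w.length + 1)) ≤ V)
    (hdV : (w.length + 1) * (w.length + 1) ≤ V) (hlV : w.length ≤ V) (hSV : labelSum w ≤ V) :
    ∃ r, Wp V n 2000 (cells P w) queryProg m r fun m' => m' 0 ≤ N ∧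
      ∀ i ≤ N, splitNum w i * splitDen w (m' 0) ≤ splitNum w (m' 0) * splitDen w i := by
  refine ⟨1 + (1 + (1 + ((7 + 1) * (N + 1) + 1))), ?_⟩
  refine Wp.seq (Wp.assign (r := 0) (v := 0) (by decide) rfl rfl (mem_cells_of_lt (by omega))
    (by omega) fun m₁ e₁ f₁ => ?_)
  refine Wp.seq (Wp.assign (r := 5) (v := 0) (by decide) rfl rfl (mem_cells_of_lt (by omega))
    (by omega) fun m₂ e₂ f₂ => ?_)
  refine Wp.seq (Wp.assign (r := 11) (v := 1) (by decide) rfl rfl (mem_cells_of_lt (by omega))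
    (by omega) fun m₃ e₃ f₃ => ?_)
  refine (Wp.loop (k := 7) (I := fun i m' => ∃ j, j + i = N + 1 ∧ Scanned N w j m')
    (by decide) ?_ (i := N + 1) ?_).mono le_rfl ?_
  · rintro i m' ⟨j, hj, hs⟩ htest
    simp only [Expr.val, hs.bound, hs.current] at htest
    refine ⟨i - 1, by omega, (wp_scanStep hs (by omega) (fun a ha => mem_cells_of_lt ha) hNV hnV
      hdV hlV hSV).mono le_rfl fun m'' _ h => ⟨j + 1, by omega, h⟩⟩
  · have h0 : m₃ 0 = 0 := by simp (disch := omega) only [f₃, f₂, e₁]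
    -- The initial fraction `0 / 1` need not be the score of split `0`; the invariant only asks that
    -- it not exceed the score of the current output.
    have h10 : m₃ 10 = 0 := by simp (disch := omega) only [f₃, f₂, f₁, hm.zero]
    exact ⟨0, by omega,
      { length := by simp (disch := omega) only [f₃, f₂, f₁, hm.length]
        total := by simp (disch := omega) only [f₃, f₂, f₁, hm.total]
        bound := by simp (disch := omega) only [f₃, f₂, f₁, hm.bound]
        current := by simp (disch := omega) only [f₃, e₂]
        prefixCount := by
          simp (disch := omega) only [f₃, f₂, f₁, hm.zero, prefixCount, Finset.range_zero,
            Finset.sum_empty]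
        prefixSum := by
          simp (disch := omega) only [f₃, f₂, f₁, hm.zero, prefixSum, Finset.range_zero,
            Finset.sum_empty]
        count := fun z => by simp (disch := omega) only [f₃, f₂, f₁, hm.count]
        sum := fun z => by simp (disch := omega) only [f₃, f₂, f₁, hm.sum]
        out_le := by omega
        den_pos := by omega
        best := by omega
        out := by rw [h10, zero_mul]; exact Nat.zero_le _ }⟩
  · rintro m₄ - ⟨⟨i, j, hj, hs⟩, htest⟩
    simp only [Expr.val, hs.bound, hs.current] at htest
    refine ⟨hs.out_le, fun i' hi' => Nat.le_of_mul_le_mul_right ?_ hs.den_pos⟩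
    calc splitNum w i' * splitDen w (m₄ 0) * m₄ 11
        = splitNum w i' * m₄ 11 * splitDen w (m₄ 0) := by ring
      _ ≤ m₄ 10 * splitDen w i' * splitDen w (m₄ 0) :=
          Nat.mul_le_mul_right _ (hs.best i' (by omega))
      _ = m₄ 10 * splitDen w (m₄ 0) * splitDen w i' := by ring
      _ ≤ splitNum w (m₄ 0) * m₄ 11 * splitDen w i' := Nat.mul_le_mul_right _ hs.out
      _ = splitNum w (m₄ 0) * splitDen w i' * m₄ 11 := by ring

/-! ### The whole run -/

theorem Fits.arrive {V n x y : ℕ} {R : Finset ℕ} {m : Mem} (h : Fits V n R m) (h0 : 0 ∈ R)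
    (h1 : 1 ∈ R) (hx : x ≤ V) (hy : y ≤ V) : Fits V n R ((m.update 0 x).update 1 y) :=
  (h.update h0 hx).update h1 hy

/-- Bound on the number of nonzero cells for streams of length at most `t`. -/
abbrev cellBound (K t : ℕ) : ℕ := 16 + 39 * K * t.size

/-- The set of addresses grows with every item, while the bounds `V` and `cellBound K t` are fixed
once for the final length, so `Fits` can be transferred to the larger set before each update. -/
theorem feed_update {V N M K H t : ℕ} (hK : 1 ≤ K) (haV : 18 + 6 * 2 ^ H ≤ V) (hMV : M ≤ V)
    (htV : t ≤ V) (hSV : t * M ≤ V) (l : List (ℕ × ℕ))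
    (hl : ∀ p ∈ l, p.1 < 2 ^ H ∧ p.2 ≤ M) {w : List (ℕ × ℕ × ℕ)} {s : State}
    (ht : w.length + l.length ≤ t) (hM : ∀ i ∈ w, i.2.2 ≤ M)
    (hm : Holds N (2 ^ H) K w s.mem) (hw : Placed (2 ^ H) K H w)
    (hf : Fits V (cellBound K t) (cells (2 ^ H) w) s.mem)
    (hp : s.peak ≤ (2 * cellBound K t + 2000) * V.size)
    (hs : s.slowest ≤ (2 * H + 10) * (1 + 2000 * V.size)) :
    ∃ s' w', Feed updateProg l s (PMF.pure s') ∧ Holds N (2 ^ H) K w' s'.mem ∧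
      Placed (2 ^ H) K H w' ∧ Fits V (cellBound K t) (cells (2 ^ H) w') s'.mem ∧
      s'.peak ≤ (2 * cellBound K t + 2000) * V.size ∧
      s'.slowest ≤ (2 * H + 10) * (1 + 2000 * V.size) ∧ (∀ i ∈ w', i.2.2 ≤ M) ∧
      w'.map Prod.snd = l.reverse ++ w.map Prod.snd := by
  induction l generalizing w s with
  | nil => exact ⟨s, w, Feed.nil s, hm, hw, hf, hp, hs, hM, rfl⟩
  | cons p l ih =>
    obtain ⟨x, y⟩ := p
    obtain ⟨hx, hy⟩ := hl (x, y) (by simp)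
    simp only at hx hy
    rw [List.length_cons] at ht
    obtain ⟨h, hw'⟩ := hw.exists_cons hx y
    have hM' : ∀ i ∈ (h, x, y) :: w, i.2.2 ≤ M := by
      intro i hi
      rcases List.mem_cons.1 hi with rfl | hi
      exacts [hy, hM i hi]
    have harr := hf.arrive (mem_cells_of_lt (by omega)) (mem_cells_of_lt (by omega))
      (show x ≤ V by omega) (hy.trans hMV)
    have hcard : (cells (2 ^ H) ((h, x, y) :: w)).card ≤ cellBound K t := by
      refine (hw'.card_cells_le hK).trans (Nat.add_le_add_left (Nat.mul_le_mul_left _ ?_) _)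
      exact Nat.size_le_size (by rw [List.length_cons]; omega)
    have harr' := harr.mono (cells_subset_cons _ (h, x, y) w) hcard
      fun a ha => (hw'.cells_le a ha).trans haV
    obtain ⟨m', hf', hm', hr⟩ := wp_update (V := V) (n := cellBound K t) (hm.arrive (x := x) (y := y))
      (by simp [update_apply]) (by simp [update_apply]) hw' hM' (by omega) (by omega)
      ((Nat.mul_le_mul_right M (show w.length + 1 ≤ t by omega)).trans hSV) harr'
    obtain ⟨s₁, hx₁, rfl, hsl, htime, hpk⟩ := hr (s.arrive (x, y)) rfl
    have hpk₀ : (s.arrive (x, y)).peak ≤ (2 * cellBound K t + 2000) * V.size := by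
      refine max_le hp (harr.space_le.trans ?_)
      rw [add_mul]
      exact Nat.le_add_right _ _
    obtain ⟨s', w', h1, h2, h3, h4, h5, h6, h7, h8⟩ := ih (s := s₁.finish)
      (fun p hp => hl p (by simp [hp])) (by rw [List.length_cons]; omega) hM' hm' hw' hf'
      (hpk.trans (max_le hpk₀ le_rfl))
      (max_le (hsl.le.trans hs) (by simpa [State.arrive] using htime))
    refine ⟨s', w', ?_, h2, h3, h4, h5, h6, h7, by simp [h8]⟩
    have := Feed.cons (q := fun _ => PMF.pure s') hx₁ (by simpa using h1)
    rwa [PMF.pure_bind] at this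

theorem runs_splitAlgorithm {V N M k K : ℕ} {l : List (ℕ × ℕ)} {ε : ℝ}
    (hK : K = 2 * (N.size + 1) * M * M * k + 1) (hV : 2 ≤ V) (haV : 18 + 6 * 2 ^ N.size ≤ V)
    (hMV : M ≤ V) (hkV : k ≤ V) (hKV : K ≤ V) (hNV : N + 1 ≤ V) (hHV : N.size + 1 ≤ V)
    (hSV : l.length * M ≤ V) (hdV : (l.length + 1) * (l.length + 1) ≤ V)
    (hnV : 2 * ((l.length * M) * (l.length * M) * (l.length + 1)) ≤ V) (hne : l ≠ [])
    (hl : ∀ p ∈ l, p.1 ≤ N ∧ p.2 ≤ M) (hε : 0 < ε) (hk : 1 / ε ≤ k) :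
    ∃ s : State, splitAlgorithm.Runs N M k l (PMF.pure s) ∧
      s.peak ≤ (2 * cellBound K l.length + 2000) * V.size ∧
      s.slowest ≤ (2 * N.size + 10) * (1 + 2000 * V.size) ∧ s.output ≤ N ∧
      splitLoss l s.output ≤ optLoss N l + ε := by
  have hK1 : 1 ≤ K := by omega
  have hlV : l.length ≤ V := by nlinarith
  have hstart : ∀ a, 3 ≤ a → (startState N M k).mem a = 0 := fun a ha => by
    simp only [startState, update_apply]
    rw [if_neg (by omega), if_neg (by omega), if_neg (by omega)]
    rfl
  have s0 : (startState N M k).mem 0 = N := by simp [startState, update_apply]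
  have s1 : (startState N M k).mem 1 = M := by simp [startState, update_apply]
  have s2 : (startState N M k).mem 2 = k := by simp [startState, update_apply]
  have hf : Fits V (cellBound K l.length) (cells (2 ^ N.size) []) (startState N M k).mem := by
    have hp : Placed (2 ^ N.size) K N.size [] := .nil
    refine ⟨hV, (hp.card_cells_le hK1).trans (by simp), fun a ha => (hp.cells_le a ha).trans haV,
      fun a => ?_, fun a ha => mem_cells_of_lt ?_⟩
    · rcases lt_or_ge a 3 with h | h
      · interval_cases a <;> omega
      · rw [hstart a h]; omega
    · by_contra h
      exact ha (hstart a (by omega))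
  obtain ⟨r₁, hwp₁⟩ := wp_init (V := V) (n := cellBound K l.length) s0 s1 s2 hstart (by omega)
    (by omega) hHV (by omega)
  obtain ⟨m₁, hf₁, hm₁, hr₁⟩ := hwp₁ hf
  obtain ⟨s₁, hx₁, rfl, hsl₁, -, hpk₁⟩ := hr₁ _ rfl
  rw [← hK] at hm₁
  have hpk₀ : (startState N M k).peak ≤ (2 * cellBound K l.length + 2000) * V.size := by
    refine hf.space_le.trans ?_
    rw [add_mul]
    exact Nat.le_add_right _ _
  have hNP : N < 2 ^ N.size := N.lt_size_self
  obtain ⟨s₂, w, hfeed, hm₂, hw, hf₂, hpk₂, hsl₂, hM, hmap⟩ := feed_update (t := l.length) hK1 haV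
    hMV hlV hSV l (fun p hp => ⟨(hl p hp).1.trans_lt hNP, (hl p hp).2⟩) (w := []) (s := s₁)
    (by simp) (by simp) hm₁ .nil hf₁ (hpk₁.trans (max_le hpk₀ le_rfl))
    (by rw [hsl₁]; exact Nat.zero_le _)
  have hperm : l.Perm (w.map Prod.snd) := by
    rw [hmap]
    simp [l.reverse_perm.symm]
  have hlen : l.length = w.length := by simpa using hperm.length_eq
  have hS := labelSum_le hM
  rw [hlen] at hnV hdV hSV hlV
  obtain ⟨r₃, hwp₃⟩ := wp_query (V := V) (n := cellBound K l.length) hm₂ hNV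
    (le_trans (by gcongr) hnV) hdV hlV (hS.trans hSV)
  obtain ⟨m₃, -, ⟨hout, hbest⟩, hr₃⟩ := hwp₃ hf₂
  obtain ⟨s₃, hx₃, rfl, hsl₃, -, hpk₃⟩ := hr₃ { s₂ with time := 0 } rfl
  refine ⟨s₃, ?_, hpk₃.trans (max_le hpk₂ le_rfl), hsl₃.le.trans hsl₂, hout,
    splitLoss_le hε hk (by omega) hNP hw hperm hM hne hout hbest⟩
  refine ⟨PMF.pure s₁, fun _ => PMF.pure s₂, fun _ => PMF.pure s₃, hx₁, by simpa [splitAlgorithm] using hfeed,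
    ?_, ?_⟩
  · rw [PMF.pure_bind]
    simpa [splitAlgorithm] using hx₃
  · rw [PMF.pure_bind, PMF.pure_bind]

/-! ### Asymptotic bounds -/

/-- From `2 ^ (q.size - 1) ≤ q` and `log 2 > 1 / 2`. -/
theorem size_le_log {q : ℕ} (hq : 1 ≤ q) : (q.size : ℝ) ≤ 2 * Real.log q + 1 := by
  have hs : 1 ≤ q.size := Nat.size_pos.2 hq
  have h1 : 2 ^ (q.size - 1) ≤ q := Nat.lt_size.1 (by omega)
  have h2 : ((2 : ℝ) ^ (q.size - 1)) ≤ q := by exact_mod_cast h1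
  have h3 := Real.log_le_log (by positivity) h2
  rw [Real.log_pow, Nat.cast_sub hs, Nat.cast_one] at h3
  have h4 : (0 : ℝ) ≤ q.size - 1 := by
    have : (1 : ℝ) ≤ q.size := by exact_mod_cast hs
    linarith
  nlinarith [Real.log_two_gt_d9]

theorem resources_le {N M k t K b C : ℕ} {ε : ℝ} (hε : 0 < ε) (hε1 : ε < 1)
    (hk : (k : ℝ) < 1 / ε + 1) (hN1 : 1 ≤ N) (ht1 : 1 ≤ t) (hb : b = 2 + N + M + t + k)
    (hK : K = 2 * (N.size + 1) * M * M * k + 1) (hC : 1000000 ≤ C) :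
    ((((2 * cellBound K t + 2000) * (b ^ 6).size : ℕ) : ℝ) ≤
        C * (1 + (M : ℝ) ^ 2 / ε) * Real.log (2 + N + M + t + 1 / ε) ^ C) ∧
      (((2 * N.size + 10) * (1 + 2000 * (b ^ 6).size) : ℕ) : ℝ) ≤
        C * Real.log (2 + N + M + t + 1 / ε) ^ C := by
  have hinv : 1 < 1 / ε := by rwa [lt_div_iff₀ hε, one_mul]
  have hCr : (1000000 : ℝ) ≤ C := by exact_mod_cast hC
  have hNr : (1 : ℝ) ≤ N := by exact_mod_cast hN1
  have htr : (1 : ℝ) ≤ t := by exact_mod_cast ht1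
  have hMr : (0 : ℝ) ≤ M := Nat.cast_nonneg _
  have hbr : (b : ℝ) = 2 + N + M + t + k := by rw [hb]; push_cast; ring
  have hb1 : 1 ≤ b := by omega
  have hKr : (K : ℝ) = 2 * (N.size + 1) * ((M : ℝ) ^ 2 * k) + 1 := by
    rw [hK]; push_cast; ring
  clear hb hK
  generalize hX : 2 + (N : ℝ) + M + t + 1 / ε = X
  have hX5 : 5 ≤ X := by linarith
  have hΛ1 : 1 ≤ Real.log X := by
    rw [Real.le_log_iff_exp_le (by linarith)]
    linarith [Real.exp_one_lt_d9]
  have hsize : ∀ q : ℕ, 1 ≤ q → (q : ℝ) ≤ X → (q.size : ℝ) ≤ 3 * Real.log X := fun q hq hqX => by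
    have h1 := size_le_log hq
    have h2 : Real.log q ≤ Real.log X := Real.log_le_log (by exact_mod_cast hq) hqX
    linarith
  have hH : (N.size : ℝ) ≤ 3 * Real.log X := hsize N hN1 (by linarith)
  have hT : (t.size : ℝ) ≤ 3 * Real.log X := hsize t ht1 (by linarith)
  have hV : ((b ^ 6).size : ℝ) ≤ 25 * Real.log X := by
    have h1 := size_le_log (q := b ^ 6) (Nat.one_le_pow _ _ hb1)
    -- Rounding `1 / ε` up costs less than one, so `b ≤ X + 1 ≤ X²`; the constant `25` is `2 * 6 * 2
    -- + 1`.
    have h2 : (b : ℝ) ≤ X ^ 2 := by nlinarith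
    have h3 := Real.log_le_log (by exact_mod_cast hb1) h2
    rw [Real.log_pow] at h3
    rw [Nat.cast_pow, Real.log_pow] at h1
    push_cast at h1 h3
    linarith
  generalize Real.log X = Λ at *
  generalize (b ^ 6).size = v at *
  have hΛC : ∀ i ≤ C, Λ ^ i ≤ Λ ^ C := fun i hi => pow_le_pow_right₀ hΛ1 hi
  have hΛ2 : 1 ≤ Λ ^ 2 := one_le_pow₀ hΛ1
  have hv0 : (0 : ℝ) ≤ v := Nat.cast_nonneg _
  constructor
  · generalize hZ : (M : ℝ) ^ 2 / ε = Z
    have hZ0 : 0 ≤ Z := by rw [← hZ]; positivity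
    have h2 : (M : ℝ) ^ 2 * k ≤ 2 * Z := by
      calc (M : ℝ) ^ 2 * k ≤ (M : ℝ) ^ 2 * (2 * (1 / ε)) := by gcongr; linarith
        _ = 2 * Z := by rw [← hZ]; ring
    have hKΛ : (K : ℝ) ≤ 16 * Λ * (1 + Z) := by
      have h4 : 2 * (N.size + 1) * ((M : ℝ) ^ 2 * k) ≤ 2 * (4 * Λ) * (2 * Z) := by
        gcongr
        linarith
      linarith
    have h1 : (K : ℝ) * t.size ≤ 16 * Λ * (1 + Z) * (3 * Λ) := by gcongr
    have h3 : (1 : ℝ) ≤ Λ ^ 2 * (1 + Z) := one_le_mul_of_one_le_of_one_le hΛ2 (by linarith)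
    calc (((2 * cellBound K t + 2000) * v : ℕ) : ℝ)
        = (2 * (16 + 39 * (K * t.size)) + 2000) * v := by push_cast; ring
      _ ≤ 6000 * (Λ ^ 2 * (1 + Z)) * (25 * Λ) := by
          gcongr
          linarith
      _ = 150000 * (1 + Z) * Λ ^ 3 := by ring
      _ ≤ C * (1 + Z) * Λ ^ C := by
          gcongr ?_ * _ * ?_
          · linarith
          · exact hΛC 3 (by omega)
  · calc (((2 * N.size + 10) * (1 + 2000 * v) : ℕ) : ℝ)
        = (2 * N.size + 10) * (1 + 2000 * v) := by push_cast; ring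
      _ ≤ (16 * Λ) * (60000 * Λ) := by
          gcongr
          · linarith
          · linarith
      _ = 960000 * Λ ^ 2 := by ring
      _ ≤ C * Λ ^ C := by
          gcongr ?_ * ?_
          · linarith
          · exact hΛC 2 (by omega)

end SplitStream

theorem theorem1 (c : ℕ) :
    ∃ (A : SplitStream.Algorithm) (C : ℕ),
      ∀ (N M : ℕ) (ε : ℝ), 0 < ε → ε < 1 →
      ∀ l : List (ℕ × ℕ), l ≠ [] →
        (∀ p ∈ l, 1 ≤ p.1 ∧ p.1 ≤ N ∧ p.2 ≤ M) →
        ∃ P : PMF SplitStream.State,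
          A.Runs N M ⌈1 / ε⌉₊ l P ∧
          (∀ s ∈ P.support,
            (s.peak : ℝ) ≤ C * (1 + (M : ℝ) ^ 2 / ε) *
              Real.log (2 + N + M + l.length + 1 / ε) ^ C ∧
            (s.slowest : ℝ) ≤ C * Real.log (2 + N + M + l.length + 1 / ε) ^ C) ∧
          1 - 1 / (N : ℝ) ^ c ≤
            (P.toOuterMeasure {s | s.output ≤ N ∧
              SplitStream.splitLoss l s.output ≤ SplitStream.optLoss N l + ε}).toReal := by
  -- Only a lower bound on `C` is kept: as a factor it must exceed `150000` (space) and `960000`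
  -- (time), as an exponent `3` and `2`.
  obtain ⟨C, hC⟩ : ∃ C : ℕ, 1000000 ≤ C := ⟨_, le_rfl⟩
  refine ⟨SplitStream.splitAlgorithm, C, fun N M ε hε hε1 l hne hl => ?_⟩
  have hinv : 1 < 1 / ε := by rwa [lt_div_iff₀ hε, one_mul]
  have hk := Nat.le_ceil (1 / ε)
  have hk' := Nat.ceil_lt_add_one (show 0 ≤ 1 / ε by positivity)
  generalize ⌈1 / ε⌉₊ = k at *
  have hk1 : 1 ≤ k := Nat.one_le_iff_ne_zero.2 fun h => by rw [h] at hk; norm_num at hk; linarith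
  have hN1 : 1 ≤ N := by
    obtain ⟨p, hp⟩ := List.exists_mem_of_ne_nil l hne
    have := hl p hp
    omega
  have hm1 : 1 ≤ l.length := List.length_pos_iff.2 hne
  generalize ht : l.length = t at *
  generalize hb : 2 + N + M + t + k = b
  generalize hK : 2 * (N.size + 1) * M * M * k + 1 = K
  have hb5 : 5 ≤ b := by omega
  have hNs : N.size ≤ N := Nat.size_le.2 N.lt_two_pow_self
  have hP : 2 ^ N.size ≤ 2 * N := by
    have hs : N.size - 1 < N.size := Nat.sub_lt (Nat.size_pos.2 hN1) one_pos
    have h1 := Nat.lt_size.1 hs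
    have h2 : 2 ^ N.size = 2 * 2 ^ (N.size - 1) := by rw [← pow_succ']; congr 1; omega
    omega
  -- The exponent `6` comes from the numerators stored by the query, bounded by `2 (t M)² (t + 1)`,
  -- and from `K ≤ 2 b ^ 5`.
  have hpow : ∀ {i}, i ≤ 6 → b ^ i ≤ b ^ 6 := fun hi => Nat.pow_le_pow_right (by omega) hi
  have hb1 : b ≤ b ^ 6 := by simpa using hpow (i := 1) (by omega)
  have haV : 18 + 6 * 2 ^ N.size ≤ b ^ 6 := by
    refine le_trans ?_ (hpow (i := 3) (by omega))
    calc 18 + 6 * 2 ^ N.size ≤ 5 * 5 * b := by omega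
      _ ≤ b * b * b := by gcongr
      _ = b ^ 3 := by ring
  have hKV : K ≤ b ^ 6 := by
    calc K ≤ b * b * b * b * b + b * b * b * b * b := by
          rw [← hK]
          refine Nat.add_le_add ?_ (Nat.one_le_iff_ne_zero.2 (by positivity))
          gcongr <;> omega
      _ ≤ b * (b * b * b * b * b) := by nlinarith [Nat.zero_le (b * b * b * b * b)]
      _ = b ^ 6 := by ring
  have hSV : t * M ≤ b ^ 6 := by
    refine le_trans ?_ (hpow (i := 2) (by omega))
    rw [pow_two]
    gcongr <;> omega
  have hdV : (t + 1) * (t + 1) ≤ b ^ 6 := by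
    refine le_trans ?_ (hpow (i := 2) (by omega))
    rw [pow_two]
    gcongr <;> omega
  have hnV : 2 * ((t * M) * (t * M) * (t + 1)) ≤ b ^ 6 := by
    calc 2 * ((t * M) * (t * M) * (t + 1)) ≤ b * ((b * b) * (b * b) * b) := by
          gcongr <;> omega
      _ = b ^ 6 := by ring
  obtain ⟨s, hrun, hpeak, hslow, hout, hloss⟩ := SplitStream.runs_splitAlgorithm (V := b ^ 6)
    (K := K) (l := l) (k := k) (M := M) (N := N) (ε := ε) hK.symm (by omega) haV (by omega) (by omega)
    hKV (by omega) (by omega) (ht ▸ hSV) (ht ▸ hdV) (ht ▸ hnV) hne (fun p hp => (hl p hp).2) hε hk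
  refine ⟨PMF.pure s, hrun, ?_, ?_⟩
  · intro s' hs'
    obtain rfl : s' = s := by simpa using hs'
    obtain ⟨h1, h2⟩ := SplitStream.resources_le hε hε1 hk' hN1 hm1 hb.symm hK.symm hC
    exact ⟨le_trans (by rw [← ht]; exact_mod_cast hpeak) h1, le_trans (by exact_mod_cast hslow) h2⟩
  · rw [(PMF.toOuterMeasure_apply_eq_one_iff _ _).2]
    · simp
    · intro s' hs'
      obtain rfl : s' = s := by simpa using hs'
      exact ⟨hout, hloss⟩
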